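/- Let $P$ be a finite set of processes and $\Sigma$ a finite set of labels. A message sequence chart (MSC) over $P$ and $\Sigma$ is $M=(E,\to,\lhd,\mathit{loc},\lambda)$ with $E$ a nonempty finite set of events, $\mathit{loc}\colon E\to P$, $\lambda\colon E\to\Sigma$, where, writing $E_p=\mathit{loc}^{-1}(p)$: $\to$ relates only events of the same process and restricts on each $E_p$ to the direct successor relation of a total order; every event belongs to at most one pair of the message relation $\lhd$; for all $e\lhd f$ and $e'\lhd f'$ with $e,e'\in E_r$ and $f,f'\in E_s$ we have $r\ne s$ and ($e\to^* e'$ iff $f\to^* f'$); and ${\le}:=(\to\cup\lhd)^*$ is a partial order. A communicating finite-state machine (CFM) over $P$ and $\Sigma$ consists of a finite state set $S_r$, an initial state and a transition relation for each $r\in P$, a finite message set, and a set $\mathrm{Acc}\subseteq\prod_{r}S_r$ of accepting tuples; each transition carries a label in $\Sigma$ and is local, or sends a message to another process, or receives a message from another process. A run on $M$ assigns to each event a transition of its process with the label of that event, so that the first transition on each process starts in its initial state, the target state at $e$ is the source state at $f$ whenever $e\to f$, events in no pair of $\lhd$ get local transitions, and for $e\lhd f$ the event $e$ gets a send to $\mathit{loc}(f)$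 and $f$ a receive from $\mathit{loc}(e)$ of the same message. It is accepting if the tuple of last states (the initial state for a process without events) is in $\mathrm{Acc}$. A CFM recognizes the set of MSCs on which it has an accepting run. A path expression is a finite word over the letters $\to$, $\xrightarrow{*}$, $\lhd_{r,s}$ ($r\neq s$ in $P$) and $a\in\Sigma$. Its semantics $[\![\pi]\!]_M\subseteq E\times E$ is the composition of the relations of its letters (the identity for the empty word), where $\to$ and $\xrightarrow{*}$ stand for the process relation and its reflexive transitive closure, $\lhd_{r,s}$ for $\lhd\cap(E_r\times E_s)$, and $a$ for $\{(e,e)\mid\lambda(e)=a\}$. Likewise $\mathrm{Comp}(\pi)\subseteq P\times P$ is the composition of the relations $\{(r,s)\}$ for each letter $\lhd_{r,s}$ and the identity for every other letter. Let $\Pi_{p,q}$ be the set of path expressions $\pi$ with $(p,q)\in\mathrm{Comp}(\pi)$. Let $\mathrm{pred}_\pi(e)=\max\{f\in E\mid (f,e)\in[\![\pi]\!]_M\}$, with $\max\emptyset=\bot$ and $\bot<f$ for all $f\in E$. For $e\in E_q$ and $\pi,\pi'\in\Pi_{p,q}$ put $\pi\preceq_e\pi'$ iff $\mathrm{pred}_\pi(e)\le\mathrm{pred}_{\pi'}(e)$;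 this is a total preorder. For a finite set $\Pi$ of path expressions, let $\|\Pi\|=\sum_{\pi\in\Pi}|\pi|$ be the sum of the lengths, and let $\mathrm{Ord}$ be the set of preorders on $\Pi$. **Lemma.** There is an absolute constant $c$ such that for all finite $P$ and $\Sigma$, all $p,q\in P$ and every finite $\Pi\subseteq\Pi_{p,q}$ there is a CFM over $P$ and $\Sigma\times\mathrm{Ord}$, in which every process has at most $2^{c\|\Pi\|^2}$ local states, that recognizes exactly the set of MSCs $(M,\gamma)$ (with $M$ an MSC over $P$ and $\Sigma$ and $\gamma\colon E\to\mathrm{Ord}$) such that, for every event $e\in E_q$, $\gamma(e)$ is the restriction of $\preceq_e$ to $\Pi$. -/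

import Mathlib

namespace Gossip

open Relation

/-- A message sequence chart (MSC) over the processes `P` and the labels `A`: a nonempty finite
set of events with a process relation `proc` (direct successor on a process), a message relation
`msg`, a location map and a labelling. -/
structure MSC (P A : Type) where
  E : Type
  finite_E : Finite E
  nonempty_E : Nonempty E
  proc : E → E → Prop
  msg : E → E → Prop
  loc : E → P
  lab : E → A
  /-- Process edges stay on one process. -/
  proc_loc : ∀ {e f : E}, proc e f → loc e = loc f
  /-- On each process, `proc` is the direct successor relation of some total order. -/
  proc_total : ∀ p : P, ∃ _ : LinearOrder {e : E // loc e = p},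
    ∀ e f : {e : E // loc e = p}, proc e f ↔ e ⋖ f
  /-- Every event belongs to at most one message edge. -/
  msg_unique : ∀ {e f e' f' : E}, msg e f → msg e' f' →
    (e = e' ∨ e = f' ∨ f = e' ∨ f = f') → e = e' ∧ f = f'
  /-- Messages connect distinct processes and respect the FIFO policy. -/
  msg_fifo : ∀ {e f e' f' : E}, msg e f → msg e' f' → loc e = loc e' → loc f = loc f' →
    loc e ≠ loc f ∧ (ReflTransGen proc e e' ↔ ReflTransGen proc f f')
  /-- The reflexive transitive closure of `proc ∪ msg` is a partial order. -/
  le_antisymm' : ∀ {e f : E}, ReflTransGen (fun x y => proc x y ∨ msg x y) e f →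
    ReflTransGen (fun x y => proc x y ∨ msg x y) f e → e = f

theorem star_covBy {X : Type} [Finite X] [LinearOrder X] {a b : X} (h : a ≤ b) :
    ReflTransGen (· ⋖ ·) a b := by
  classical
  have := Fintype.ofFinite X
  let _ : LocallyFiniteOrder X := Fintype.toLocallyFiniteOrder
  exact le_iff_reflTransGen_covBy.1 h

/-- Letters of path expressions: a process edge, a sequence of process edges, a message edge
from `p` to `q ≠ p`, a test for the label `a`. -/
inductive Letter (P A : Type) where
  | succ : Letter P A
  | star : Letter P A
  | msg (p q : P) (h : p ≠ q) : Letter P A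
  | test (a : A) : Letter P A

/-- Path expressions are finite words of letters. -/
abbrev PathExpr (P A : Type) := List (Letter P A)

/-- `pathSize Π` is the sum of the lengths of the expressions in `Π`. -/
def pathSize {P A : Type} (Pi : Finset (PathExpr P A)) : ℕ := ∑ π ∈ Pi, π.length

/-- The pairs of processes compatible with a letter. -/
def Letter.Comp {P A : Type} : Letter P A → P → P → Prop
  | .succ => fun p q => p = q
  | .star => fun p q => p = q
  | .msg p' q' _ => fun p q => p = p' ∧ q = q'
  | .test _ => fun p q => p = q

/-- The pairs of processes compatible with a path expression. -/
def PathComp {P A : Type} : PathExpr P A → P → P → Prop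
  | [] => fun p q => p = q
  | x :: π => Relation.Comp x.Comp (PathComp π)

/-- The set of path expressions from `p` to `q`. -/
def Paths {P : Type} (A : Type) (p q : P) : Set (PathExpr P A) := {π | PathComp π p q}

namespace MSC

variable {P A B : Type}

/-- The events located on process `p`. -/
abbrev Events (M : MSC P A) (p : P) : Type := {e : M.E // M.loc e = p}

/-- The order on events is the reflexive transitive closure of `proc ∪ msg`. -/
instance (M : MSC P A) : PartialOrder M.E where
  le := ReflTransGen (fun x y => M.proc x y ∨ M.msg x y)
  le_refl _ := ReflTransGen.refl
  le_trans _ _ _ := ReflTransGen.trans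
  le_antisymm _ _ := M.le_antisymm'

instance (M : MSC P A) : Finite M.E := M.finite_E

/-- The MSC with every label `a` replaced by `g a`. -/
def relabel (M : MSC P A) (g : A → B) : MSC P B where
  E := M.E
  finite_E := M.finite_E
  nonempty_E := M.nonempty_E
  proc := M.proc
  msg := M.msg
  loc := M.loc
  lab e := g (M.lab e)
  proc_loc := M.proc_loc
  proc_total := M.proc_total
  msg_unique := M.msg_unique
  msg_fifo := M.msg_fifo
  le_antisymm' := M.le_antisymm'

/-- The MSC `M` over `A` underlying an extended MSC `(M, ξ)`. -/
abbrev base (N : MSC P (A × B)) : MSC P A := N.relabel Prod.fst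

/-- The second component `ξ` of an extended MSC `(M, ξ)`. -/
def ext (N : MSC P (A × B)) (e : N.base.E) : B := (N.lab e).2

/-- Semantics of a letter. -/
def semLetter (M : MSC P A) : Letter P A → M.E → M.E → Prop
  | .succ => M.proc
  | .star => ReflTransGen M.proc
  | .msg p q _ => fun e f => M.loc e = p ∧ M.loc f = q ∧ M.msg e f
  | .test a => fun e f => e = f ∧ M.lab e = a

/-- Semantics of a path expression. -/
def sem (M : MSC P A) : PathExpr P A → M.E → M.E → Prop
  | [] => fun e f => e = f
  | x :: π => Relation.Comp (M.semLetter x) (M.sem π)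

theorem le_or_le (M : MSC P A) {e f : M.E} (h : M.loc e = M.loc f) : e ≤ f ∨ f ≤ e := by
  obtain ⟨lo, hlo⟩ := M.proc_total (M.loc f)
  have key : ∀ a b : M.Events (M.loc f), lo.le a b → (a : M.E) ≤ b := fun a b hab =>
    ReflTransGen.lift (p := fun x y : M.E => M.proc x y ∨ M.msg x y) Subtype.val
      (fun x y hxy => Or.inl ((hlo x y).2 hxy)) _ _ (star_covBy hab)
  exact (lo.le_total ⟨e, h⟩ ⟨f, rfl⟩).imp (key _ _) (key _ _)

theorem loc_eq_of_star (M : MSC P A) {e f : M.E} (h : ReflTransGen M.proc e f) :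
    M.loc e = M.loc f := by
  induction h with
  | refl => rfl
  | tail _ h ih => exact ih.trans (M.proc_loc h)

theorem comp_of_semLetter (M : MSC P A) {x : Letter P A} {e f : M.E}
    (h : M.semLetter x e f) : x.Comp (M.loc e) (M.loc f) := by
  cases x with
  | succ => exact M.proc_loc h
  | star => exact M.loc_eq_of_star h
  | msg p q _ => exact ⟨h.1, h.2.1⟩
  | test a => exact congrArg M.loc h.1

theorem comp_of_sem (M : MSC P A) {π : PathExpr P A} {e f : M.E} (h : M.sem π e f) :
    PathComp π (M.loc e) (M.loc f) := by
  induction π generalizing e with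
  | nil => exact congrArg M.loc h
  | cons x π ih =>
    obtain ⟨g, h1, h2⟩ := h
    exact ⟨M.loc g, M.comp_of_semLetter h1, ih h2⟩

end MSC

theorem PathComp.left_unique {P A : Type} {π : PathExpr P A} {p p' q : P}
    (h : PathComp π p q) (h' : PathComp π p' q) : p = p' := by
  induction π generalizing p p' with
  | nil => exact Eq.trans h (Eq.symm h')
  | cons x π ih =>
    obtain ⟨r, h1, h2⟩ := h
    obtain ⟨r', h1', h2'⟩ := h'
    obtain rfl := ih h2 h2'
    cases x with
    | succ => exact Eq.trans h1 (Eq.symm h1')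
    | star => exact Eq.trans h1 (Eq.symm h1')
    | msg a b _ => exact h1.1.trans h1'.1.symm
    | test a => exact Eq.trans h1 (Eq.symm h1')

namespace MSC

variable {P A : Type}

/-- If there is an event with a `π`-path to `e`, then there is a most recent one. -/
theorem exists_isGreatest (M : MSC P A) (π : PathExpr P A) (e : M.E)
    (h : ∃ f, M.sem π f e) : ∃ f, IsGreatest {f | M.sem π f e} f := by
  obtain ⟨f, hf⟩ := (Set.toFinite {f | M.sem π f e}).exists_maximal h
  refine ⟨f, hf.1, fun g hg => ?_⟩
  have hl : M.loc g = M.loc f := (M.comp_of_sem hg).left_unique (M.comp_of_sem hf.1)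
  exact (M.le_or_le hl).elim id (fun hfg => hf.2 hg hfg)

open Classical in
/-- `pred π e` is the most recent event with a `π`-path to `e`, and `⊥` if there is none. -/
noncomputable def pred (M : MSC P A) (π : PathExpr P A) (e : M.E) : WithBot M.E :=
  if h : ∃ f, M.sem π f e then ((M.exists_isGreatest π e h).choose : WithBot M.E) else ⊥

/-- `π ≼_e π'`: the most recent `π`-predecessor of `e` is below the most recent
`π'`-predecessor of `e`. -/
def PrefLE (M : MSC P A) (e : M.E) (π π' : PathExpr P A) : Prop := M.pred π e ≤ M.pred π' e

end MSC

/-- The set of preorders over `X`. -/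
def PreOrd (X : Type) : Type := {r : X → X → Prop // (∀ x, r x x) ∧ ∀ x y z, r x y → r y z → r x z}

instance {X : Type} [Finite X] : Finite (PreOrd X) :=
  inferInstanceAs (Finite {_r : X → X → Prop // _})

/-- The restriction of `≼_e` to `Π`, as an element of `PreOrd Π`. -/
def MSC.prefOrd {P A : Type} (M : MSC P A) (Pi : Finset (PathExpr P A)) (e : M.E) :
    PreOrd {π : PathExpr P A // π ∈ Pi} :=
  ⟨fun π π' => M.PrefLE e π π', fun _ => le_rfl (α := WithBot M.E),
    fun _ _ _ => le_trans (α := WithBot M.E)⟩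

/-- For expressions from `p` to `q`, the preorder `≼_e` is total. -/
theorem MSC.prefLE_total {P A : Type} (M : MSC P A) {p q : P} {π π' : PathExpr P A}
    (h : π ∈ Paths A p q) (h' : π' ∈ Paths A p q) {e : M.E} (he : M.loc e = q) :
    M.PrefLE e π π' ∨ M.PrefLE e π' π := by
  subst he
  unfold MSC.PrefLE MSC.pred
  split_ifs with h1 h2 h2
  · have a1 := (M.exists_isGreatest π e h1).choose_spec.1
    have a2 := (M.exists_isGreatest π' e h2).choose_spec.1
    have b1 := PathComp.left_unique (M.comp_of_sem a1) h
    have b2 := PathComp.left_unique (M.comp_of_sem a2) h'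
    exact (M.le_or_le (b1.trans b2.symm)).imp WithBot.coe_le_coe.2 WithBot.coe_le_coe.2
  · exact Or.inr bot_le
  · exact Or.inl bot_le
  · exact Or.inl bot_le

/-- What a transition of process `p` does: a local action, sending message `m` to `q ≠ p`,
or receiving message `m` from `q ≠ p`; in each case with a label `a`. -/
inductive Action (P A Msg : Type) (p : P) where
  | loc (a : A) : Action P A Msg p
  | send (a : A) (m : Msg) (q : P) (h : q ≠ p) : Action P A Msg p
  | recv (a : A) (m : Msg) (q : P) (h : q ≠ p) : Action P A Msg p

/-- The label of an action. -/
def Action.label {P A Msg : Type} {p : P} : Action P A Msg p → A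
  | .loc a => a
  | .send a _ _ _ => a
  | .recv a _ _ _ => a

/-- Transitions of process `p` with state set `S`. -/
structure Transition (P A Msg : Type) (p : P) (S : Type) where
  source : S
  act : Action P A Msg p
  target : S

/-- A communicating finite-state machine (CFM) over the processes `P` and the labels `A`. -/
structure CFM (P A : Type) where
  /-- The local states of each process. -/
  S : P → Type
  finite_S : ∀ p, Finite (S p)
  /-- The messages. -/
  Msg : Type
  finite_Msg : Finite Msg
  init : ∀ p, S p
  Δ : ∀ p, Set (Transition P A Msg p (S p))
  /-- The accepting collections of final local states. -/
  Acc : Set (∀ p, S p)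

namespace CFM

variable {P A : Type}

/-- `ρ` is a run of `C` on `M`. -/
structure IsRun (C : CFM P A) (M : MSC P A)
    (ρ : ∀ p, M.Events p → Transition P A C.Msg p (C.S p)) : Prop where
  mem : ∀ p (e : M.Events p), ρ p e ∈ C.Δ p
  label : ∀ p (e : M.Events p), (ρ p e).act.label = M.lab e
  first : ∀ p (e : M.Events p), (∀ f, ¬ M.proc f e) → (ρ p e).source = C.init p
  edge : ∀ p (e f : M.Events p), M.proc e f → (ρ p e).target = (ρ p f).source
  internal : ∀ p (e : M.Events p), (∀ f, ¬ M.msg e f) → (∀ f, ¬ M.msg f e) →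
    ∃ a, (ρ p e).act = .loc a
  message : ∀ p q (e : M.Events p) (f : M.Events q), M.msg e f →
    ∃ a b m h h', (ρ p e).act = .send a m q h ∧ (ρ q f).act = .recv b m p h'

/-- The run `ρ` ends, on every process, in the local states given by `s`. -/
def EndsIn (C : CFM P A) (M : MSC P A)
    (ρ : ∀ p, M.Events p → Transition P A C.Msg p (C.S p)) (s : ∀ p, C.S p) : Prop :=
  ∀ p, (IsEmpty (M.Events p) → s p = C.init p) ∧
    ∀ e : M.Events p, (∀ f, ¬ M.proc e f) → s p = (ρ p e).target

/-- The set of MSCs on which `C` has an accepting run. -/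
def language (C : CFM P A) : Set (MSC P A) :=
  {M | ∃ ρ, C.IsRun M ρ ∧ ∃ s ∈ C.Acc, C.EndsIn M ρ s}

end CFM

end Gossip

/-! A machine may guess auxiliary labels, so it suffices to build, for each ordered pair of distinct
expressions `π`, `π'`, a nondeterministic machine with `2 ^ O(|π| + |π'|)` states that checks a
guessed bit claiming `π ≼_e π'`. Since `Π` has at most `‖Π‖ + 1` elements, the product over all
pairs has `2 ^ O(‖Π‖²)` states.

Events cannot be named in bounded memory, but they can carry colours. By the FIFO policy, most
recent predecessors are monotone along a process, so `pred (π ++ [x]) e` equals `pred π f` for the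
last `x`-predecessor `f` of `e` at which `pred π` is defined. With three bits per letter, a machine
can thus carry a colour from `pred π e` forward to `e` and a mark from `e` back to `pred π e`
(`Rec.transport`).

It remains to certify `α ≤ β` on a set `H` for the monotone maps `α = pred π` and `β = pred π'`. If
the inequality holds, choose representatives `R ⊆ H` greedily: `e` joins `R` when `α e` lies beyond
`β r` for every earlier `r ∈ R`. The intervals `[α e, β e]` with `e ∈ R` are then disjoint. Colour
every event on `p` by the parity of the number of points of `β '' R` strictly before it. For `e ∈ R`
the colours of `α e` and `β e` agree with the parity of the number of representatives before `e`;
for `e ∈ H \ R` the value `α e` does not pass `β d`, where `d` is the last representative before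
`e`, so its colour is the opposite one. Conversely, these parities and one betweenness condition
force `α ≤ β` (`Certificate.sound`, `exists_certificate`).

A negative answer means that `pred π' e < pred π e`. Unless `pred π' e = ⊥`, this says `pred π' e ≤
pred (.succ :: π) e`, so the same certificates verify both answers. -/

namespace Gossip

open Relation

/-! ### Process neighbours and message partners -/

namespace MSC

variable {P A : Type}

theorem proc_left_unique (M : MSC P A) {e f g : M.E} (h : M.proc f e) (h' : M.proc g e) :
    f = g := by
  obtain ⟨lo, hlo⟩ := M.proc_total (M.loc e)
  have h1 := (hlo ⟨f, M.proc_loc h⟩ ⟨e, rfl⟩).1 h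
  have h2 := (hlo ⟨g, M.proc_loc h'⟩ ⟨e, rfl⟩).1 h'
  exact congrArg Subtype.val (h1.unique_left h2)

theorem proc_right_unique (M : MSC P A) {e f g : M.E} (h : M.proc e f) (h' : M.proc e g) :
    f = g := by
  obtain ⟨lo, hlo⟩ := M.proc_total (M.loc e)
  have h1 := (hlo ⟨e, rfl⟩ ⟨f, (M.proc_loc h).symm⟩).1 h
  have h2 := (hlo ⟨e, rfl⟩ ⟨g, (M.proc_loc h').symm⟩).1 h'
  exact congrArg Subtype.val (h1.unique_right h2)

theorem loc_ne_of_msg (M : MSC P A) {e f : M.E} (h : M.msg e f) : M.loc e ≠ M.loc f :=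
  (M.msg_fifo h h rfl rfl).1

theorem not_msg_msg (M : MSC P A) {e f g : M.E} (h : M.msg e f) (h' : M.msg f g) : False := by
  obtain ⟨rfl, rfl⟩ := M.msg_unique h h' (by simp)
  exact M.loc_ne_of_msg h rfl

/-- The total order provided by `proc_total` is contained in the partial order `≤`. A total order
contained in a partial order equals it, so the two have the same covering relation. -/
theorem proc_iff_covBy (M : MSC P A) {p : P} {e f : M.Events p} :
    M.proc e f ↔ e ⋖ f := by
  obtain ⟨lo, hlo⟩ := M.proc_total p
  have key : ∀ a b : M.Events p, lo.le a b → a ≤ b := fun a b hab =>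
    ReflTransGen.lift (p := fun x y : M.E => M.proc x y ∨ M.msg x y) Subtype.val
      (fun x y hxy => Or.inl ((hlo x y).2 hxy)) _ _ (star_covBy hab)
  have key' : ∀ a b : M.Events p, lo.le a b ↔ a ≤ b := fun a b =>
    ⟨key a b, fun hab => (lo.le_total a b).elim id fun hba =>
      (le_antisymm (key _ _ hba) hab : b = a) ▸ lo.le_refl _⟩
  have hlt : ∀ a b : M.Events p, lo.lt a b ↔ a < b := fun a b => by
    rw [lo.lt_iff_le_not_ge, key', key', lt_iff_le_not_ge]
  rw [hlo]
  exact and_congr (hlt _ _) (forall_congr' fun c =>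
    imp_congr (hlt _ _) (not_congr (hlt _ _)))

open Classical in
/-- The process predecessor of an event. -/
noncomputable def prev (M : MSC P A) (e : M.E) : Option M.E :=
  if h : ∃ f, M.proc f e then some h.choose else none

open Classical in
/-- The event that sent the message received at `e`. -/
noncomputable def sender (M : MSC P A) (e : M.E) : Option M.E :=
  if h : ∃ f, M.msg f e then some h.choose else none

open Classical in
/-- The event that receives the message sent at `e`. -/
noncomputable def receiver (M : MSC P A) (e : M.E) : Option M.E :=
  if h : ∃ f, M.msg e f then some h.choose else none

theorem prev_eq_some (M : MSC P A) {e f : M.E} : M.prev e = some f ↔ M.proc f e := by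
  unfold prev
  split_ifs with h
  · rw [Option.some_inj]
    exact ⟨fun h' => h' ▸ h.choose_spec, fun h' => M.proc_left_unique h.choose_spec h'⟩
  · simpa using fun h' => h ⟨f, h'⟩

theorem sender_eq_some (M : MSC P A) {e f : M.E} : M.sender e = some f ↔ M.msg f e := by
  unfold sender
  split_ifs with h
  · rw [Option.some_inj]
    exact ⟨fun h' => h' ▸ h.choose_spec,
      fun h' => (M.msg_unique h.choose_spec h' (by simp)).1⟩
  · simpa using fun h' => h ⟨f, h'⟩

theorem receiver_eq_some (M : MSC P A) {e f : M.E} : M.receiver e = some f ↔ M.msg e f := by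
  unfold receiver
  split_ifs with h
  · rw [Option.some_inj]
    exact ⟨fun h' => h' ▸ h.choose_spec,
      fun h' => (M.msg_unique h.choose_spec h' (by simp)).2⟩
  · simpa using fun h' => h ⟨f, h'⟩

theorem prev_eq_none (M : MSC P A) {e : M.E} : M.prev e = none ↔ ∀ f, ¬ M.proc f e := by
  simp only [Option.eq_none_iff_forall_ne_some, ne_eq, prev_eq_some]

theorem sender_eq_none (M : MSC P A) {e : M.E} : M.sender e = none ↔ ∀ f, ¬ M.msg f e := by
  simp only [Option.eq_none_iff_forall_ne_some, ne_eq, sender_eq_some]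

theorem receiver_eq_none (M : MSC P A) {e : M.E} : M.receiver e = none ↔ ∀ f, ¬ M.msg e f := by
  simp only [Option.eq_none_iff_forall_ne_some, ne_eq, receiver_eq_some]

end MSC

/-! ### Machines with uniform local states, and the CFMs that simulate them -/

/-- A machine with the same local states `S` on every process, which reads an MSC over `A`
together with a `B`-labelling of its events. Every message carries the local state of its sender.
The arguments of `step` are the process, the state before the event, the sending process and the
state of the sender for a receive event, the target process for a send event, the labels in `A`
and `B`, and the state after the event. -/
structure Machine (P A B S : Type) where
  init : S
  step : P → S → Option (P × S) → Option P → A → B → S → Prop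
  acc : S → Prop
  -- A process without events ends in its initial state, which therefore must not prevent
  -- acceptance.
  acc_init : acc init

namespace Machine

variable {P A B S : Type}

/-- `σ` assigns to each event the local state after it. -/
def IsRun (X : Machine P A B S) (M : MSC P A) (ξ : M.E → B) (σ : M.E → S) : Prop :=
  (∀ e, X.step (M.loc e) ((M.prev e).elim X.init σ) ((M.sender e).map fun f => (M.loc f, σ f))
    ((M.receiver e).map M.loc) (M.lab e) (ξ e) (σ e)) ∧
  ∀ e, (∀ f, ¬ M.proc e f) → X.acc (σ e)

/-- The transitions of the CFM that simulates a machine. -/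
def Trans (X : Machine P A B S) (r : P) (s : S) (s' : S) : Action P (A × B) S r → Prop
  | .loc a => X.step r s none none a.1 a.2 s'
  | .send a m q _ => m = s' ∧ X.step r s none (some q) a.1 a.2 s'
  | .recv a m q _ => X.step r s (some (q, m)) none a.1 a.2 s'

/-- The CFM that simulates a machine. -/
def toCFM [Finite S] (X : Machine P A B S) : CFM P (A × B) where
  S _ := S
  finite_S _ := inferInstance
  Msg := S
  finite_Msg := inferInstance
  init _ := X.init
  Δ r := {t | X.Trans r t.source t.target t.act}
  Acc := {s | ∀ r, X.acc (s r)}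

open Classical in
/-- The action at an event in a run of `toCFM`. -/
noncomputable def action (M : MSC P (A × B)) (σ : M.E → S) (e : M.E) :
    Action P (A × B) S (M.loc e) :=
  if h : ∃ f, M.msg f e then
    .recv (M.lab e) (σ h.choose) (M.loc h.choose) (M.loc_ne_of_msg h.choose_spec)
  else if h : ∃ f, M.msg e f then
    .send (M.lab e) (σ e) (M.loc h.choose) (M.loc_ne_of_msg h.choose_spec).symm
  else .loc (M.lab e)

theorem action_recv (M : MSC P (A × B)) (σ : M.E → S) {e f : M.E} (h : M.msg f e) :
    action M σ e = .recv (M.lab e) (σ f) (M.loc f) (M.loc_ne_of_msg h) := by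
  have h' : ∃ f, M.msg f e := ⟨f, h⟩
  have hf : h'.choose = f := (M.msg_unique h'.choose_spec h (by simp)).1
  unfold action
  rw [dif_pos h']
  simp only [hf]

theorem action_send (M : MSC P (A × B)) (σ : M.E → S) {e f : M.E} (h : M.msg e f) :
    action M σ e = .send (M.lab e) (σ e) (M.loc f) (M.loc_ne_of_msg h).symm := by
  have h' : ∃ f, M.msg e f := ⟨f, h⟩
  have hf : h'.choose = f := (M.msg_unique h'.choose_spec h (by simp)).2
  unfold action
  rw [dif_neg (fun ⟨g, hg⟩ => M.not_msg_msg hg h), dif_pos h']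
  simp only [hf]

theorem action_loc (M : MSC P (A × B)) (σ : M.E → S) {e : M.E} (h : ∀ f, ¬ M.msg e f)
    (h' : ∀ f, ¬ M.msg f e) : action M σ e = .loc (M.lab e) := by
  unfold action
  rw [dif_neg (fun ⟨g, hg⟩ => h' g hg), dif_neg (fun ⟨g, hg⟩ => h g hg)]

theorem action_label (M : MSC P (A × B)) (σ : M.E → S) (e : M.E) :
    (action M σ e).label = M.lab e := by
  unfold action
  split_ifs <;> rfl

theorem exists_last (M : MSC P A) (p : P) (h : ¬ IsEmpty (M.Events p)) :
    ∃ e : M.Events p, ∀ f, ¬ M.proc e f := by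
  have : Nonempty (M.Events p) := not_isEmpty_iff.1 h
  obtain ⟨e, -, he⟩ := (Set.toFinite (Set.univ : Set (M.Events p))).exists_maximal Set.univ_nonempty
  refine ⟨e, fun f hf => ?_⟩
  have hl : M.loc f = p := (M.proc_loc hf).symm.trans e.2
  exact (M.proc_iff_covBy (f := ⟨f, hl⟩).1 hf).lt.not_ge 
    (he trivial (M.proc_iff_covBy (f := ⟨f, hl⟩).1 hf).le)

/-- A sent message is the target state of the send, so a run of the CFM is determined by its target
states. Acceptance is a conjunction of conditions on the processes and can be checked at the last
events. -/
theorem mem_language_toCFM [Finite S] (X : Machine P A B S) (N : MSC P (A × B)) :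
    N ∈ X.toCFM.language ↔ ∃ σ, X.IsRun N.base N.ext σ := by
  constructor
  · rintro ⟨ρ, hρ, s, hs, hend⟩
    refine ⟨fun e => (ρ (N.loc e) ⟨e, rfl⟩).target, fun e => ?_, fun e he => ?_⟩
    · have hsrc : ((N.prev e).elim X.init fun e => (ρ (N.loc e) ⟨e, rfl⟩).target) =
          (ρ (N.loc e) ⟨e, rfl⟩).source := by
        rcases h : N.prev e with _ | f
        · exact (hρ.first _ ⟨e, rfl⟩ (N.prev_eq_none.1 h)).symm
        · have h := N.prev_eq_some.1 h
          have hl := N.proc_loc h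
          have key : ∀ r (h1 : N.loc f = r) (h2 : N.loc e = r),
              (ρ r ⟨f, h1⟩).target = (ρ r ⟨e, h2⟩).source :=
            fun r h1 h2 => hρ.edge r ⟨f, h1⟩ ⟨e, h2⟩ h
          refine Eq.trans ?_ (key _ hl rfl)
          have : ∀ r (h1 : N.loc f = r), (ρ (N.loc f) ⟨f, rfl⟩).target = (ρ r ⟨f, h1⟩).target := by
            rintro r rfl; rfl
          exact this _ hl
      have hmem := hρ.mem _ ⟨e, rfl⟩
      have hlab := hρ.label _ ⟨e, rfl⟩
      change X.step (N.loc e) ((N.prev e).elim X.init fun e => (ρ (N.loc e) ⟨e, rfl⟩).target)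
        ((N.sender e).map fun f => (N.loc f, (ρ (N.loc f) ⟨f, rfl⟩).target))
        ((N.receiver e).map N.loc) (N.lab e).1 (N.lab e).2 _
      rw [hsrc]
      change X.Trans _ _ _ (ρ (N.loc e) ⟨e, rfl⟩).act at hmem
      rcases h1 : N.sender e with _ | f
      · rcases h2 : N.receiver e with _ | g
        · obtain ⟨a, ha⟩ := hρ.internal _ ⟨e, rfl⟩ (N.receiver_eq_none.1 h2)
            (N.sender_eq_none.1 h1)
          rw [ha] at hmem hlab
          simp only [Action.label] at hlab
          subst hlab
          exact hmem
        · have h2' := N.receiver_eq_some.1 h2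
          obtain ⟨a, b, m, h, h', ha, hb⟩ := hρ.message _ _ ⟨e, rfl⟩ ⟨g, rfl⟩ h2'
          rw [ha] at hmem hlab
          simp only [Action.label] at hlab
          subst hlab
          exact hmem.2
      · have h1' := N.sender_eq_some.1 h1
        have h2 : N.receiver e = none := N.receiver_eq_none.2 fun g hg => N.not_msg_msg h1' hg
        rw [h2]
        obtain ⟨a, b, m, h, h', ha, hb⟩ := hρ.message _ _ ⟨f, rfl⟩ ⟨e, rfl⟩ h1'
        have hmem' := hρ.mem _ ⟨f, rfl⟩
        change X.Trans _ _ _ (ρ (N.loc f) ⟨f, rfl⟩).act at hmem'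
        rw [ha] at hmem'
        rw [hb] at hmem hlab
        simp only [Action.label] at hlab
        subst hlab
        have := hmem'.1
        subst this
        exact hmem
    · have := (hend (N.loc e)).2 ⟨e, rfl⟩ he
      change X.acc (ρ (N.loc e) ⟨e, rfl⟩).target
      exact this ▸ hs (N.loc e)
  · rintro ⟨σ, hσ, hacc⟩
    classical
    let ρ : ∀ p, N.Events p → Transition P (A × B) S p S := fun p e =>
      { source := (N.prev e.1).elim X.init σ
        act := e.2 ▸ action N σ e.1
        target := σ e.1 }
    refine ⟨ρ, ⟨?_, ?_, ?_, ?_, ?_, ?_⟩, fun p => if h : IsEmpty (N.Events p) then X.init else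
      σ (exists_last N p h).choose.1, ?_, ?_⟩
    · rintro p ⟨e, rfl⟩
      have h := hσ e
      change X.step (N.loc e) ((N.prev e).elim X.init σ)
        ((N.sender e).map fun f => (N.loc f, σ f)) ((N.receiver e).map N.loc)
        (N.lab e).1 (N.lab e).2 _ at h
      change X.Trans (N.loc e) ((N.prev e).elim X.init σ) (σ e) (action N σ e)
      rcases h1 : N.sender e with _ | f
      · rw [h1] at h
        rcases h2 : N.receiver e with _ | g
        · rw [h2] at h
          rw [action_loc N σ (N.receiver_eq_none.1 h2) (N.sender_eq_none.1 h1)]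
          exact h
        · rw [h2] at h
          rw [action_send N σ (N.receiver_eq_some.1 h2)]
          exact ⟨rfl, h⟩
      · have h1' := N.sender_eq_some.1 h1
        have h2 : N.receiver e = none := N.receiver_eq_none.2 fun g hg => N.not_msg_msg h1' hg
        rw [h1, h2] at h
        rw [action_recv N σ h1']
        exact h
    · rintro p ⟨e, rfl⟩
      exact action_label N σ e
    · rintro p ⟨e, rfl⟩ h
      change (N.prev e).elim X.init σ = X.init
      rw [N.prev_eq_none.2 h]; rfl
    · rintro p ⟨e, he⟩ ⟨f, hf⟩ h
      change σ e = (N.prev f).elim X.init σ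
      rw [N.prev_eq_some.2 h]; rfl
    · rintro p ⟨e, rfl⟩ h h'
      exact ⟨_, action_loc N σ h h'⟩
    · rintro p q ⟨e, rfl⟩ ⟨f, rfl⟩ h
      exact ⟨_, _, _, _, _, action_send N σ h, action_recv N σ h⟩
    · intro p
      change X.acc (dite _ _ _)
      split_ifs with h
      · exact X.acc_init
      · exact hacc _ (exists_last N p h).choose_spec
    · refine fun p => ⟨fun h => dif_pos h, fun e he => ?_⟩
      have hne : ¬ IsEmpty (N.Events p) := fun h => h.elim e
      change dite _ _ _ = σ e.1
      rw [dif_neg hne]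
      have h2 := (exists_last N p hne).choose_spec
      set g := (exists_last N p hne).choose
      have key : ∀ a b : N.Events p, (∀ f, ¬ N.proc a f) → b ≤ a := fun a b ha => by
        refine (N.le_or_le (b.2.trans a.2.symm)).elim id fun hab => ?_
        by_contra hba
        obtain ⟨c, hc, -⟩ := exists_covBy_le_of_lt (lt_of_le_not_ge (α := N.Events p) hab hba)
        exact ha c (N.proc_iff_covBy.2 hc)
      rw [show g = e from le_antisymm (key e g he) (key g e h2)]

end Machine

/-! ### Closure properties of recognizability -/

/-- `Φ` is recognized by a machine with at most `2 ^ n` local states. -/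
def Rec (P A B : Type) (n : ℕ) (Φ : (M : MSC P A) → (M.E → B) → Prop) : Prop :=
  ∃ (S : Type) (_ : Finite S) (X : Machine P A B S), Nat.card S ≤ 2 ^ n ∧
    ∀ M ξ, Φ M ξ ↔ ∃ σ, X.IsRun M ξ σ

namespace Rec

variable {P A B C : Type} {n m : ℕ}

theorem exists_cfm {Φ : (M : MSC P A) → (M.E → B) → Prop} (h : Rec P A B n Φ) :
    ∃ C : CFM P (A × B), (∀ r, Nat.card (C.S r) ≤ 2 ^ n) ∧
      C.language = {N | Φ N.base N.ext} := by
  obtain ⟨S, _, X, hX, hΦ⟩ := h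
  refine ⟨X.toCFM, fun _ => hX, ?_⟩
  ext N
  rw [X.mem_language_toCFM, Set.mem_ofPred_eq, hΦ]

theorem congr {Φ Ψ : (M : MSC P A) → (M.E → B) → Prop} (h : Rec P A B n Φ)
    (hΨ : ∀ M ξ, Ψ M ξ ↔ Φ M ξ) : Rec P A B n Ψ := by
  obtain ⟨S, _, X, hX, hΦ⟩ := h
  exact ⟨S, ‹_›, X, hX, fun M ξ => (hΨ M ξ).trans (hΦ M ξ)⟩

theorem mono {Φ : (M : MSC P A) → (M.E → B) → Prop} (h : Rec P A B n Φ) (hnm : n ≤ m) :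
    Rec P A B m Φ := by
  obtain ⟨S, _, X, hX, hΦ⟩ := h
  exact ⟨S, ‹_›, X, hX.trans (Nat.pow_le_pow_right (by norm_num) hnm), hΦ⟩

theorem comap {Φ : (M : MSC P A) → (M.E → B) → Prop} (h : Rec P A B n Φ) (g : C → B) :
    Rec P A C n fun M ξ => Φ M fun e => g (ξ e) := by
  obtain ⟨S, _, X, hX, hΦ⟩ := h
  exact ⟨S, ‹_›, ⟨X.init, fun r s i o a c s' => X.step r s i o a (g c) s', X.acc, X.acc_init⟩, hX,
    fun M ξ => hΦ M _⟩

/-- The machine guesses `ζ` event by event inside its transition relation, so existentially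
quantified labels cost no states. -/
theorem proj {Φ : (M : MSC P A) → (M.E → B × C) → Prop} (h : Rec P A (B × C) n Φ) :
    Rec P A B n fun M ξ => ∃ ζ : M.E → C, Φ M fun e => (ξ e, ζ e) := by
  obtain ⟨S, _, X, hX, hΦ⟩ := h
  refine ⟨S, ‹_›, ⟨X.init, fun r s i o a b s' => ∃ c, X.step r s i o a (b, c) s', X.acc,
    X.acc_init⟩, hX, fun M ξ => ?_⟩
  simp only [hΦ]
  constructor
  · rintro ⟨ζ, σ, hσ⟩
    exact ⟨σ, fun e => ⟨ζ e, hσ.1 e⟩, hσ.2⟩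
  · rintro ⟨σ, hσ⟩
    choose ζ hζ using hσ.1
    exact ⟨ζ, σ, hζ, hσ.2⟩

/-- Product machine: messages carry pairs of states, and each component reads its own half.
Exponents of state bounds add up. -/
theorem and {Φ Ψ : (M : MSC P A) → (M.E → B) → Prop} (h : Rec P A B n Φ) (h' : Rec P A B m Ψ) :
    Rec P A B (n + m) fun M ξ => Φ M ξ ∧ Ψ M ξ := by
  obtain ⟨S, _, X, hX, hΦ⟩ := h
  obtain ⟨T, _, Y, hY, hΨ⟩ := h'
  refine ⟨S × T, inferInstance, ⟨(X.init, Y.init), fun r s i o a b s' =>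
    X.step r s.1 (i.map fun j => (j.1, j.2.1)) o a b s'.1 ∧
    Y.step r s.2 (i.map fun j => (j.1, j.2.2)) o a b s'.2, fun s => X.acc s.1 ∧ Y.acc s.2,
    X.acc_init, Y.acc_init⟩, ?_, fun M ξ => ?_⟩
  · rw [Nat.card_prod, pow_add]
    exact Nat.mul_le_mul hX hY
  have e1 : ∀ (σ : M.E → S × T) e, ((M.prev e).elim (X.init, Y.init) σ).1 =
      (M.prev e).elim X.init fun e => (σ e).1 := fun σ e => by cases M.prev e <;> rfl
  have e2 : ∀ (σ : M.E → S × T) e, ((M.prev e).elim (X.init, Y.init) σ).2 =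
      (M.prev e).elim Y.init fun e => (σ e).2 := fun σ e => by cases M.prev e <;> rfl
  simp only [hΦ, hΨ, Machine.IsRun, Option.map_map, Function.comp_def, e1, e2]
  constructor
  · rintro ⟨⟨σ, hσ⟩, τ, hτ⟩
    exact ⟨fun e => (σ e, τ e), fun e => ⟨hσ.1 e, hτ.1 e⟩, fun e he => ⟨hσ.2 e he, hτ.2 e he⟩⟩
  · rintro ⟨σ, hσ⟩
    exact ⟨⟨fun e => (σ e).1, fun e => (hσ.1 e).1, fun e he => (hσ.2 e he).1⟩,
      ⟨fun e => (σ e).2, fun e => (hσ.1 e).2, fun e he => (hσ.2 e he).2⟩⟩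

/-- A condition on the process and the labels of each single event. -/
theorem all_events (Q : P → A → B → Prop) :
    Rec P A B 0 fun M ξ => ∀ e, Q (M.loc e) (M.lab e) (ξ e) :=
  ⟨Unit, inferInstance, ⟨(), fun r _ _ _ a b _ => Q r a b, fun _ => True, trivial⟩, by simp,
    fun _ _ => ⟨fun h => ⟨fun _ => (), h, fun _ _ => trivial⟩, fun ⟨_, h⟩ => h.1⟩⟩

theorem finset_all {ι : Type} (s : Finset ι) (k : ι → ℕ)
    (Φ : ι → (M : MSC P A) → (M.E → B) → Prop) (h : ∀ i ∈ s, Rec P A B (k i) (Φ i)) :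
    Rec P A B (∑ i ∈ s, k i) fun M ξ => ∀ i ∈ s, Φ i M ξ := by
  classical
  induction s using Finset.induction_on with
  | empty => exact (all_events fun _ _ _ => True).congr (by simp)
  | insert i s hi ih =>
    rw [Finset.sum_insert hi]
    refine ((h i (by simp)).and (ih fun j hj => h j (by simp [hj]))).congr fun M ξ => ?_
    simp

end Rec

/-! ### Most recent predecessors along a path expression -/

namespace MSC

variable {P A : Type}

theorem lt_of_proc (M : MSC P A) {f e : M.E} (h : M.proc f e) : f < e :=
  (M.proc_iff_covBy (e := ⟨f, M.proc_loc h⟩) (f := ⟨e, rfl⟩).1 h).lt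

theorem le_of_lt_of_proc (M : MSC P A) {f e g : M.E} (h : M.proc f e) (hg : M.loc g = M.loc e)
    (hlt : g < e) : g ≤ f := by
  have hc := M.proc_iff_covBy (e := ⟨f, M.proc_loc h⟩) (f := ⟨e, rfl⟩).1 h
  refine (M.le_or_le (hg.trans (M.proc_loc h).symm)).elim id fun hfg => ?_
  by_contra hgf
  exact hc.2 (c := ⟨g, hg⟩) (lt_of_le_not_ge hfg hgf) hlt

theorem le_of_proc_of_lt (M : MSC P A) {f e g : M.E} (h : M.proc f e) (hg : M.loc g = M.loc f)
    (hlt : f < g) : e ≤ g := by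
  refine (M.le_or_le ((M.proc_loc h).symm.trans hg.symm)).elim id fun hge => ?_
  by_contra heg
  exact (lt_of_lt_of_le hlt (M.le_of_lt_of_proc h (hg.trans (M.proc_loc h))
    (lt_of_le_not_ge hge heg))).false

theorem exists_proc_left (M : MSC P A) {f e : M.E} (hl : M.loc f = M.loc e) (h : f < e) :
    ∃ g, M.proc g e := by
  obtain ⟨c, -, hc⟩ := exists_le_covBy_of_lt (show (⟨f, hl⟩ : M.Events (M.loc e)) < ⟨e, rfl⟩ from h)
  exact ⟨c, M.proc_iff_covBy.2 hc⟩

theorem exists_proc_right (M : MSC P A) {f e : M.E} (hl : M.loc f = M.loc e) (h : f < e) :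
    ∃ g, M.proc f g := by
  obtain ⟨c, hc, -⟩ := exists_covBy_le_of_lt (show (⟨f, hl⟩ : M.Events (M.loc e)) < ⟨e, rfl⟩ from h)
  exact ⟨c, M.proc_iff_covBy.2 hc⟩

theorem star_iff (M : MSC P A) {f e : M.E} :
    ReflTransGen M.proc f e ↔ M.loc f = M.loc e ∧ f ≤ e := by
  refine ⟨fun h => ⟨M.loc_eq_of_star h, ReflTransGen.mono (fun _ _ => Or.inl) _ _ h⟩, ?_⟩
  rintro ⟨hl, hle⟩
  induction e using (wellFounded_lt (α := M.E)).induction with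
  | _ e ih =>
    rcases hle.eq_or_lt with rfl | hlt
    · exact ReflTransGen.refl
    · obtain ⟨g, hg⟩ := M.exists_proc_left hl hlt
      exact (ih g (M.lt_of_proc hg) (hl.trans (M.proc_loc hg).symm)
        (M.le_of_lt_of_proc hg hl hlt)).tail hg

theorem exists_isGreatest_of_loc (M : MSC P A) {s : Set M.E} (hs : s.Nonempty)
    (hl : ∀ e ∈ s, ∀ f ∈ s, M.loc e = M.loc f) : ∃ f, IsGreatest s f := by
  obtain ⟨f, hf⟩ := (Set.toFinite s).exists_maximal hs
  exact ⟨f, hf.1, fun g hg => (M.le_or_le (hl g hg f hf.1)).elim id (fun hfg => hf.2 hg hfg)⟩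

theorem loc_eq_of_semLetter (M : MSC P A) {x : Letter P A} {e e' f f' : M.E}
    (h : M.semLetter x e f) (h' : M.semLetter x e' f') (hl : M.loc f = M.loc f') :
    M.loc e = M.loc e' := by
  cases x with
  | succ => rw [M.proc_loc h, M.proc_loc h', hl]
  | star => rw [M.loc_eq_of_star h, M.loc_eq_of_star h', hl]
  | msg p q _ => rw [h.1, h'.1]
  | test a => rw [h.1, h'.1, hl]

theorem semLetter_left_unique (M : MSC P A) {x : Letter P A} (hx : x ≠ .star) {e e' f : M.E}
    (h : M.semLetter x e f) (h' : M.semLetter x e' f) : e = e' := by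
  cases x with
  | succ => exact M.proc_left_unique h h'
  | star => exact absurd rfl hx
  | msg p q _ => exact (M.msg_unique h.2.2 h'.2.2 (by simp)).1
  | test a => rw [h.1, h'.1]

theorem sem_concat (M : MSC P A) {π : PathExpr P A} {x : Letter P A} {f e : M.E} :
    M.sem (π ++ [x]) f e ↔ ∃ g, M.sem π f g ∧ M.semLetter x g e := by
  induction π generalizing f with
  | nil => simp [sem, Relation.Comp]
  | cons y π ih =>
    simp only [List.cons_append, sem, Relation.Comp, ih]
    constructor
    · rintro ⟨g, h1, g', h2, h3⟩
      exact ⟨g', ⟨g, h1, h2⟩, h3⟩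
    · rintro ⟨g', ⟨g, h1, h2⟩, h3⟩
      exact ⟨g, h1, g', h2, h3⟩

theorem pred_eq_coe (M : MSC P A) {π : PathExpr P A} {e f : M.E} :
    M.pred π e = (f : WithBot M.E) ↔ IsGreatest {f | M.sem π f e} f := by
  unfold pred
  split_ifs with h
  · rw [WithBot.coe_inj]
    exact ⟨fun h' => h' ▸ (M.exists_isGreatest π e h).choose_spec,
      fun h' => (M.exists_isGreatest π e h).choose_spec.unique h'⟩
  · simpa using fun h' => h ⟨f, h'.1⟩

theorem pred_ne_bot (M : MSC P A) {π : PathExpr P A} {e : M.E} :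
    M.pred π e ≠ ⊥ ↔ ∃ f, M.sem π f e := by
  rw [WithBot.ne_bot_iff_exists]
  constructor
  · rintro ⟨f, hf⟩
    exact ⟨f, (M.pred_eq_coe.1 hf.symm).1⟩
  · intro h
    obtain ⟨f, hf⟩ := M.exists_isGreatest π e h
    exact ⟨f, (M.pred_eq_coe.2 hf).symm⟩

theorem pred_nil (M : MSC P A) (e : M.E) : M.pred [] e = e :=
  M.pred_eq_coe.2 ⟨rfl, fun f (hf : f = e) => hf.le⟩

/-- By the FIFO policy, the most recent predecessors depend monotonically on the event. -/
theorem exists_sem_ge (M : MSC P A) {π : PathExpr P A} {e e' g : M.E} (h : M.sem π g e)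
    (h' : ∃ g, M.sem π g e') (hl : M.loc e = M.loc e') (hle : e ≤ e') :
    ∃ g', M.sem π g' e' ∧ g ≤ g' := by
  induction π using List.reverseRecOn generalizing e e' g with
  | nil => exact ⟨e', rfl, (show g = e from h).trans_le hle⟩
  | append_singleton π x ih =>
    obtain ⟨f, hf, hx⟩ := M.sem_concat.1 h
    obtain ⟨g', hg'⟩ := h'
    obtain ⟨f', hf', hx'⟩ := M.sem_concat.1 hg'
    cases x with
    | star =>
      -- A trailing star absorbs the step from `e` to `e'`, so the same `g` serves.
      exact ⟨g, M.sem_concat.2 ⟨f, hf, ReflTransGen.trans hx (M.star_iff.2 ⟨hl, hle⟩)⟩, le_rfl⟩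
    | succ =>
      have hff : f ≤ f' := by
        rcases hle.eq_or_lt with rfl | hlt
        · exact (M.proc_left_unique hx hx').le
        · exact (M.lt_of_proc hx).le.trans (M.le_of_lt_of_proc hx' hl hlt)
      obtain ⟨k, hk, hgk⟩ := ih hf ⟨_, hf'⟩ (M.loc_eq_of_semLetter hx hx' hl) hff
      exact ⟨k, M.sem_concat.2 ⟨f', hk, hx'⟩, hgk⟩
    | msg p q _ =>
      have hff : f ≤ f' := (M.star_iff.1 ((M.msg_fifo hx.2.2 hx'.2.2 (hx.1.trans hx'.1.symm)
        hl).2.2 (M.star_iff.2 ⟨hl, hle⟩))).2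
      obtain ⟨k, hk, hgk⟩ := ih hf ⟨_, hf'⟩ (M.loc_eq_of_semLetter hx hx' hl) hff
      exact ⟨k, M.sem_concat.2 ⟨f', hk, hx'⟩, hgk⟩
    | test a =>
      have hff : f ≤ f' := hx.1.trans_le (hle.trans hx'.1.ge)
      obtain ⟨k, hk, hgk⟩ := ih hf ⟨_, hf'⟩ (M.loc_eq_of_semLetter hx hx' hl) hff
      exact ⟨k, M.sem_concat.2 ⟨f', hk, hx'⟩, hgk⟩

theorem pred_mono (M : MSC P A) {π : PathExpr P A} {e e' g g' : M.E}
    (h : M.pred π e = (g : WithBot M.E)) (h' : M.pred π e' = (g' : WithBot M.E))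
    (hl : M.loc e = M.loc e') (hle : e ≤ e') : g ≤ g' := by
  rw [pred_eq_coe] at h h'
  obtain ⟨k, hk, hgk⟩ := M.exists_sem_ge h.1 ⟨_, h'.1⟩ hl hle
  exact hgk.trans (h'.2 hk)

/-- `f` is the last event satisfying `D` from which the letter `x` leads to `e`. -/
def Last (M : MSC P A) (x : Letter P A) (D : M.E → Prop) (f e : M.E) : Prop :=
  IsGreatest {f | M.semLetter x f e ∧ D f} f

/-- Among the `x`-predecessors of `e` at which `pred π` is defined, the last one has the greatest
`π`-predecessor, by `exists_sem_ge`. Thus a single intermediate event has to be followed, even for a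
star. -/
theorem pred_concat (M : MSC P A) {π : PathExpr P A} {x : Letter P A} {e g : M.E} :
    M.pred (π ++ [x]) e = (g : WithBot M.E) ↔
      ∃ f, M.Last x (fun f => M.pred π f ≠ ⊥) f e ∧ M.pred π f = (g : WithBot M.E) := by
  have hloc : ∀ f h, M.semLetter x f e → M.semLetter x h e → M.loc f = M.loc h :=
    fun f h hf hh => M.loc_eq_of_semLetter hf hh rfl
  constructor
  · intro hg
    rw [pred_eq_coe] at hg
    obtain ⟨h, hgh, hx⟩ := M.sem_concat.1 hg.1
    obtain ⟨f, hf⟩ := M.exists_isGreatest_of_loc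
      (s := {f | M.semLetter x f e ∧ M.pred π f ≠ ⊥}) ⟨h, hx, M.pred_ne_bot.2 ⟨g, hgh⟩⟩
      fun f hf f' hf' => hloc f f' hf.1 hf'.1
    refine ⟨f, hf, ?_⟩
    rw [pred_eq_coe]
    obtain ⟨k, hk, hgk⟩ := M.exists_sem_ge hgh (M.pred_ne_bot.1 hf.1.2) (hloc _ _ hx hf.1.1)
      (hf.2 ⟨hx, M.pred_ne_bot.2 ⟨g, hgh⟩⟩)
    have hkg : k = g := le_antisymm (hg.2 (M.sem_concat.2 ⟨f, hk, hf.1.1⟩)) hgk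
    exact ⟨hkg ▸ hk, fun k' hk' => hg.2 (M.sem_concat.2 ⟨f, hk', hf.1.1⟩)⟩
  · rintro ⟨f, hf, hg⟩
    rw [pred_eq_coe] at hg ⊢
    refine ⟨M.sem_concat.2 ⟨f, hg.1, hf.1.1⟩, fun k hk => ?_⟩
    obtain ⟨h, hkh, hx⟩ := M.sem_concat.1 hk
    obtain ⟨k', hk', hkk'⟩ := M.exists_sem_ge hkh ⟨_, hg.1⟩ (hloc _ _ hx hf.1.1)
      (hf.2 ⟨hx, M.pred_ne_bot.2 ⟨k, hkh⟩⟩)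
    exact hkk'.trans (hg.2 hk')

/-- A leading process edge moves `pred π e` one step back on its process. This turns strict
comparisons of predecessors into weak ones. -/
theorem pred_succ_cons (M : MSC P A) {π : PathExpr P A} {e g : M.E} :
    M.pred (.succ :: π) e = (g : WithBot M.E) ↔
      ∃ h, M.proc g h ∧ M.pred π e = (h : WithBot M.E) := by
  constructor
  · intro hg
    rw [pred_eq_coe] at hg
    obtain ⟨h, hgh, hh⟩ := hg.1
    obtain ⟨k, hk⟩ := M.exists_isGreatest π e ⟨h, hh⟩
    have hl : M.loc h = M.loc k := (M.comp_of_sem hh).left_unique (M.comp_of_sem hk.1)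
    have hhk : h ≤ k := hk.2 hh
    obtain ⟨g', hg'⟩ := M.exists_proc_left ((M.proc_loc hgh).trans hl)
      (lt_of_lt_of_le (M.lt_of_proc hgh) hhk)
    have h1 : g' ≤ g := hg.2 ⟨k, hg', hk.1⟩
    have h2 : g ≤ g' := M.le_of_lt_of_proc hg' ((M.proc_loc hgh).trans hl)
      (lt_of_lt_of_le (M.lt_of_proc hgh) hhk)
    exact ⟨k, le_antisymm h1 h2 ▸ hg', M.pred_eq_coe.2 hk⟩
  · rintro ⟨h, hgh, hh⟩
    rw [pred_eq_coe] at hh ⊢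
    refine ⟨⟨h, hgh, hh.1⟩, ?_⟩
    rintro g' ⟨h', hg'h', hh'⟩
    have hl : M.loc h' = M.loc h := (M.comp_of_sem hh').left_unique (M.comp_of_sem hh.1)
    exact M.le_of_lt_of_proc hgh ((M.proc_loc hg'h').trans hl)
      (lt_of_lt_of_le (M.lt_of_proc hg'h') (hh.2 hh'))

theorem last_iff (M : MSC P A) {x : Letter P A} (hx : x ≠ .star) {D : M.E → Prop} {f e : M.E} :
    M.Last x D f e ↔ M.semLetter x f e ∧ D f :=
  ⟨fun h => h.1, fun h => ⟨h, fun _ hg => (M.semLetter_left_unique hx hg.1 h.1).le⟩⟩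

theorem last_star_iff (M : MSC P A) {D : M.E → Prop} {f e : M.E} :
    M.Last .star D f e ↔ D f ∧ M.loc f = M.loc e ∧ f ≤ e ∧
      ∀ g, M.loc g = M.loc f → f < g → g ≤ e → ¬ D g := by
  constructor
  · rintro ⟨⟨h, hD⟩, hm⟩
    have h := M.star_iff.1 h
    exact ⟨hD, h.1, h.2, fun g hl hlt hle hg =>
      (lt_of_lt_of_le hlt (hm ⟨M.star_iff.2 ⟨hl.trans h.1, hle⟩, hg⟩)).false⟩
  · rintro ⟨hD, hl, hle, h⟩
    refine ⟨⟨M.star_iff.2 ⟨hl, hle⟩, hD⟩, fun g ⟨hg, hDg⟩ => ?_⟩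
    have hg := M.star_iff.1 hg
    refine (M.le_or_le (hg.1.trans hl.symm)).elim id fun hfg => ?_
    by_contra hgf
    exact h g (hg.1.trans hl.symm) (lt_of_le_not_ge hfg hgf) hg.2 hDg

theorem last_star_of_mem (M : MSC P A) {D : M.E → Prop} {f e : M.E} (he : D e) :
    M.Last .star D f e ↔ f = e := by
  rw [last_star_iff]
  constructor
  · rintro ⟨-, hl, hle, h⟩
    by_contra hne
    exact h e hl.symm (lt_of_le_of_ne hle hne) le_rfl he
  · rintro rfl
    exact ⟨he, rfl, le_rfl, fun g _ h1 h2 => absurd (lt_of_lt_of_le h1 h2) (lt_irrefl _)⟩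

/-- Together with `last_star_of_mem` this is the forward recursion by which a machine remembers the
last event in `D`; `until_iff` is its backward counterpart for marks. -/
theorem last_star_of_notMem (M : MSC P A) {D : M.E → Prop} {f e : M.E} (he : ¬ D e) :
    M.Last .star D f e ↔ ∃ g, M.proc g e ∧ M.Last .star D f g := by
  simp only [last_star_iff]
  constructor
  · rintro ⟨hD, hl, hle, h⟩
    have hlt : f < e := lt_of_le_of_ne hle fun hfe => he (hfe ▸ hD)
    obtain ⟨g, hg⟩ := M.exists_proc_left hl hlt
    exact ⟨g, hg, hD, hl.trans (M.proc_loc hg).symm, M.le_of_lt_of_proc hg hl hlt,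
      fun k hk h1 h2 => h k hk h1 (h2.trans (M.lt_of_proc hg).le)⟩
  · rintro ⟨g, hg, hD, hl, hle, h⟩
    refine ⟨hD, hl.trans (M.proc_loc hg), hle.trans (M.lt_of_proc hg).le, fun k hk h1 h2 => ?_⟩
    rcases h2.eq_or_lt with rfl | h2
    · exact he
    · exact h k hk h1 (M.le_of_lt_of_proc hg (hk.trans (hl.trans (M.proc_loc hg))) h2)

/-- Some event satisfying `H` follows `e` on its process, and no event satisfying `D` in between. -/
def Until (M : MSC P A) (D H : M.E → Prop) (e : M.E) : Prop :=
  ∃ f, M.loc e = M.loc f ∧ e ≤ f ∧ H f ∧ ∀ g, M.loc g = M.loc e → e < g → g ≤ f → ¬ D g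

theorem until_iff (M : MSC P A) {D H : M.E → Prop} {e : M.E} :
    M.Until D H e ↔ H e ∨ ∃ g, M.proc e g ∧ ¬ D g ∧ M.Until D H g := by
  constructor
  · rintro ⟨f, hl, hle, hf, h⟩
    rcases hle.eq_or_lt with rfl | hlt
    · exact Or.inl hf
    · obtain ⟨g, hg⟩ := M.exists_proc_right hl hlt
      have hgf : g ≤ f := M.le_of_proc_of_lt hg hl.symm hlt
      have hgl := M.proc_loc hg
      exact Or.inr ⟨g, hg, h g hgl.symm (M.lt_of_proc hg) hgf, f, hgl.symm.trans hl, hgf, hf,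
        fun k hk h1 h2 => h k (hk.trans hgl.symm) ((M.lt_of_proc hg).trans h1) h2⟩
  · rintro (he | ⟨g, hg, hD, f, hl, hle, hf, h⟩)
    · exact ⟨e, rfl, le_rfl, he, fun g _ h1 h2 => absurd (lt_of_lt_of_le h1 h2) (lt_irrefl _)⟩
    · have hgl := M.proc_loc hg
      refine ⟨f, hgl.trans hl, (M.lt_of_proc hg).le.trans hle, hf, fun k hk h1 h2 => ?_⟩
      rcases (M.le_of_proc_of_lt hg hk h1).eq_or_lt with rfl | h3
      · exact hD
      · exact h k (hk.trans hgl) h3 h2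

theorem exists_last_star_iff (M : MSC P A) {D H : M.E → Prop} {f : M.E} :
    (∃ e, M.Last .star D f e ∧ H e) ↔ D f ∧ M.Until D H f := by
  simp only [last_star_iff]
  constructor
  · rintro ⟨e, ⟨hD, hl, hle, h⟩, he⟩
    exact ⟨hD, e, hl, hle, he, h⟩
  · rintro ⟨hD, e, hl, hle, he, h⟩
    exact ⟨e, ⟨hD, hl, hle, h⟩, he⟩

end MSC

/-! ### Transport of colours and marks along path expressions -/

namespace MSC

variable {P A : Type}

/-- `c` arises from the colouring `c'` by following the letter `x`, and `G'` marks the events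
used by events marked by `H`. -/
def Transfer (M : MSC P A) (x : Letter P A) (c' : M.E → Option Bool) (G' : M.E → Bool)
    (c : M.E → Option Bool) (H : M.E → Bool) : Prop :=
  (∀ e k, c e = some k ↔ ∃ f, M.Last x (fun f => c' f ≠ none) f e ∧ c' f = some k) ∧
  ∀ f, G' f = true ↔ ∃ e, M.Last x (fun f => c' f ≠ none) f e ∧ H e = true

/-- `c e` is the colour of `pred π e`, and `G` marks the events `pred π e` for the events `e`
marked by `H`. -/
def Transport (M : MSC P A) (π : PathExpr P A) (κ G : M.E → Bool)
    (c : M.E → Option Bool) (H : M.E → Bool) : Prop :=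
  (∀ e k, c e = some k ↔ ∃ g : M.E, M.pred π e = (g : WithBot M.E) ∧ κ g = k) ∧
  ∀ g, G g = true ↔ ∃ e, M.pred π e = (g : WithBot M.E) ∧ H e = true

theorem transport_nil (M : MSC P A) {κ G : M.E → Bool} {c : M.E → Option Bool} {H : M.E → Bool} :
    M.Transport [] κ G c H ↔ ∀ e, c e = some (κ e) ∧ G e = H e := by
  simp only [Transport, pred_nil, WithBot.coe_inj, exists_eq_left', exists_eq_left]
  refine ⟨fun h e => ⟨(h.1 e _).2 rfl, Bool.eq_iff_iff.2 (h.2 e)⟩, fun h => ⟨fun e k => ?_,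
    fun e => by rw [(h e).2]⟩⟩
  rw [(h e).1, Option.some_inj]

theorem Transport.ne_none_iff {M : MSC P A} {π : PathExpr P A} {κ G : M.E → Bool}
    {c : M.E → Option Bool} {H : M.E → Bool} (h : M.Transport π κ G c H) (e : M.E) :
    c e ≠ none ↔ M.pred π e ≠ ⊥ := by
  rw [Option.ne_none_iff_exists', WithBot.ne_bot_iff_exists]
  constructor
  · rintro ⟨k, hk⟩
    obtain ⟨g, hg, -⟩ := (h.1 e k).1 hk
    exact ⟨g, hg.symm⟩
  · rintro ⟨g, hg⟩
    exact ⟨κ g, (h.1 e _).2 ⟨g, hg.symm, rfl⟩⟩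

open Classical in
theorem transport_exists (M : MSC P A) (π : PathExpr P A) (κ : M.E → Bool) (H : M.E → Bool) :
    ∃ G c, M.Transport π κ G c H := by
  have h : ∀ e, ∃ o : Option Bool, ∀ k, o = some k ↔
      ∃ g : M.E, M.pred π e = (g : WithBot M.E) ∧ κ g = k := fun e => by
    induction M.pred π e using WithBot.recBotCoe with
    | bot => exact ⟨none, by simp⟩
    | coe g => exact ⟨some (κ g), by simp⟩
  choose c hc using h
  exact ⟨fun g => decide (∃ e, M.pred π e = (g : WithBot M.E) ∧ H e = true), c, hc, by simp⟩

open Classical in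
-- Colours pass forward through `π` and then `x`, marks pass back through `x` and then `π`. The
-- intermediate labelling `ζ` holds both, and `pred_concat` says that the two stages compose.
theorem transport_concat (M : MSC P A) {π : PathExpr P A} {x : Letter P A} {κ G : M.E → Bool}
    {c : M.E → Option Bool} {H : M.E → Bool} :
    M.Transport (π ++ [x]) κ G c H ↔ ∃ ζ : M.E → Option Bool × Bool,
      M.Transport π κ G (fun e => (ζ e).1) (fun e => (ζ e).2) ∧
      M.Transfer x (fun e => (ζ e).1) (fun e => (ζ e).2) c H := by
  constructor
  · intro h
    obtain ⟨_, c', hc'⟩ := M.transport_exists π κ fun _ => false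
    have hD : (fun f => c' f ≠ none) = fun f => M.pred π f ≠ ⊥ :=
      funext fun f => propext (hc'.ne_none_iff f)
    refine ⟨fun f => (c' f, decide (∃ e, M.Last x (fun f => c' f ≠ none) f e ∧ H e = true)),
      ⟨hc'.1, fun g => ?_⟩, fun e k => ?_, fun f => ?_⟩
    · rw [h.2]
      simp only [decide_eq_true_eq, pred_concat, hD]
      constructor
      · rintro ⟨e, ⟨f, h1, h2⟩, h3⟩
        exact ⟨f, h2, e, h1, h3⟩
      · rintro ⟨f, h2, e, h1, h3⟩
        exact ⟨e, ⟨f, h1, h2⟩, h3⟩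
    · rw [h.1]
      simp only [pred_concat, hD, hc'.1]
      constructor
      · rintro ⟨g, ⟨f, h1, h2⟩, h3⟩
        exact ⟨f, h1, g, h2, h3⟩
      · rintro ⟨f, h1, g, h2, h3⟩
        exact ⟨g, ⟨f, h1, h2⟩, h3⟩
    · simp
  · rintro ⟨ζ, h, h'⟩
    have hD : (fun f => (ζ f).1 ≠ none) = fun f => M.pred π f ≠ ⊥ :=
      funext fun f => propext (h.ne_none_iff f)
    refine ⟨fun e k => ?_, fun g => ?_⟩
    · rw [h'.1]
      simp only [pred_concat, hD, h.1]
      constructor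
      · rintro ⟨f, h1, g, h2, h3⟩
        exact ⟨g, ⟨f, h1, h2⟩, h3⟩
      · rintro ⟨g, ⟨f, h1, h2⟩, h3⟩
        exact ⟨f, h1, g, h2, h3⟩
    · rw [h.2]
      simp only [pred_concat, h'.2, hD]
      constructor
      · rintro ⟨f, h2, e, h1, h3⟩
        exact ⟨e, ⟨f, h1, h2⟩, h3⟩
      · rintro ⟨e, ⟨f, h1, h2⟩, h3⟩
        exact ⟨f, h2, e, h1, h3⟩

end MSC

/-! ### Machines for transport -/

namespace Rec

variable {P A : Type}

/-- The labels read by the machine for a letter: colours and marks before and after it. -/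
abbrev TransferLabel : Type := (Option Bool × Bool) × (Option Bool × Bool)

theorem transfer_test (a : A) : Rec P A TransferLabel 3 fun M ξ =>
    M.Transfer (.test a) (fun e => (ξ e).1.1) (fun e => (ξ e).1.2) (fun e => (ξ e).2.1)
      (fun e => (ξ e).2.2) := by
  refine ((all_events fun _ b l => (∀ k, l.2.1 = some k ↔ b = a ∧ l.1.1 = some k) ∧
    (l.1.2 = true ↔ b = a ∧ l.1.1 ≠ none ∧ l.2.2 = true)).mono (by norm_num)).congr fun M ξ => ?_
  have hL : ∀ f e, M.Last (.test a) (fun f => (ξ f).1.1 ≠ none) f e ↔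
      (f = e ∧ M.lab f = a) ∧ (ξ f).1.1 ≠ none := fun f e => M.last_iff (by simp)
  simp only [MSC.Transfer, hL, ← forall_and]
  refine forall_congr' fun e => and_congr (forall_congr' fun k => iff_congr Iff.rfl ?_)
    (iff_congr Iff.rfl ?_)
  · constructor
    · rintro ⟨f, ⟨⟨rfl, h1⟩, -⟩, h2⟩
      exact ⟨h1, h2⟩
    · rintro ⟨h1, h2⟩
      exact ⟨e, ⟨⟨rfl, h1⟩, by simp [h2]⟩, h2⟩
  · constructor
    · rintro ⟨f, ⟨⟨rfl, h1⟩, h3⟩, h2⟩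
      exact ⟨h1, h3, h2⟩
    · rintro ⟨h1, h2, h3⟩
      exact ⟨e, ⟨⟨rfl, h1⟩, h2⟩, h3⟩

theorem card_transferState : Nat.card (Option Bool × Bool) ≤ 2 ^ 3 := by
  simp [Nat.card_eq_fintype_card]

theorem transfer_succ : Rec P A TransferLabel 3 fun M ξ =>
    M.Transfer .succ (fun e => (ξ e).1.1) (fun e => (ξ e).1.2) (fun e => (ξ e).2.1)
      (fun e => (ξ e).2.2) := by
  -- The state repeats the colour and mark of the current event. A mark is a promise checked at the
  -- next event of the process, and a promise still open at the end is rejected.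
  refine ⟨Option Bool × Bool, inferInstance, ⟨(none, false), fun _ s _ _ _ l s' =>
    s' = l.1 ∧ l.2.1 = s.1 ∧ (s.2 = true ↔ s.1 ≠ none ∧ l.2.2 = true), fun s => s.2 = false, rfl⟩,
    card_transferState, fun M ξ => ?_⟩
  have hL : ∀ f e, M.Last .succ (fun f => (ξ f).1.1 ≠ none) f e ↔
      M.proc f e ∧ (ξ f).1.1 ≠ none := fun f e => M.last_iff (by simp)
  simp only [MSC.Transfer, hL]
  constructor
  · rintro ⟨h1, h2⟩
    refine ⟨fun e => (ξ e).1, fun e => ⟨rfl, ?_⟩, fun e he => ?_⟩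
    · rcases hp : M.prev e with _ | f
      · rw [M.prev_eq_none] at hp
        refine ⟨Option.eq_none_iff_forall_ne_some.2 fun k hk => ?_, by simp⟩
        obtain ⟨f, hf, -⟩ := (h1 e k).1 hk
        exact hp f hf.1
      · rw [M.prev_eq_some] at hp
        refine ⟨Option.ext fun k => ?_, ?_⟩
        · rw [h1]
          constructor
          · rintro ⟨g, hg, hk⟩
            exact M.proc_left_unique hp hg.1 ▸ hk
          · exact fun hk => ⟨f, ⟨hp, by simp_all⟩, hk⟩
        · change (ξ f).1.2 = true ↔ _
          rw [h2]
          constructor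
          · rintro ⟨g, hg, hk⟩
            exact ⟨hg.2, M.proc_right_unique hp hg.1 ▸ hk⟩
          · exact fun hk => ⟨e, ⟨hp, hk.1⟩, hk.2⟩
    · change (ξ e).1.2 = false
      rw [← Bool.not_eq_true, h2]
      rintro ⟨g, hg, -⟩
      exact he g hg.1
  · rintro ⟨σ, hσ, hacc⟩
    obtain rfl : σ = fun e => (ξ e).1 := funext fun e => (hσ e).1
    refine ⟨fun e k => ?_, fun f => ?_⟩
    · rw [(hσ e).2.1]
      rcases hp : M.prev e with _ | f
      · rw [M.prev_eq_none] at hp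
        simpa using fun f hf => absurd hf (hp f)
      · rw [M.prev_eq_some] at hp
        constructor
        · exact fun hk => ⟨f, ⟨hp, by simp_all⟩, hk⟩
        · rintro ⟨g, hg, hk⟩
          exact M.proc_left_unique hp hg.1 ▸ hk
    · by_cases hf : ∃ e, M.proc f e
      · obtain ⟨e, he⟩ := hf
        have h := (hσ e).2.2
        rw [M.prev_eq_some.2 he] at h
        rw [show (ξ f).1.2 = true ↔ _ from h]
        constructor
        · exact fun hk => ⟨e, ⟨he, hk.1⟩, hk.2⟩
        · rintro ⟨g, hg, hk⟩
          exact ⟨hg.2, M.proc_right_unique he hg.1 ▸ hk⟩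
      · rw [show (ξ f).1.2 = false from hacc f fun e he => hf ⟨e, he⟩]
        simpa using fun e he => absurd ⟨e, he⟩ hf

theorem transfer_msg (r s : P) (hrs : r ≠ s) : Rec P A TransferLabel 3 fun M ξ =>
    M.Transfer (.msg r s hrs) (fun e => (ξ e).1.1) (fun e => (ξ e).1.2) (fun e => (ξ e).2.1)
      (fun e => (ξ e).2.2) := by
  -- Colour and mark travel with the message, and the receive event checks them. The last clause
  -- makes every marked event a send from `r` to `s`, so that its mark does get checked.
  refine ⟨Option Bool × Bool, inferInstance, ⟨(none, false), fun p _ i o _ l s' =>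
    s' = l.1 ∧ (∀ k, l.2.1 = some k ↔ ∃ t, i = some (r, t) ∧ p = s ∧ t.1 = some k) ∧
    (∀ t, i = some (r, t) → p = s → (t.2 = true ↔ t.1 ≠ none ∧ l.2.2 = true)) ∧
    (s'.2 = true → p = r ∧ o = some s), fun _ => True, trivial⟩,
    card_transferState, fun M ξ => ?_⟩
  have hL : ∀ f e, M.Last (.msg r s hrs) (fun f => (ξ f).1.1 ≠ none) f e ↔
      (M.loc f = r ∧ M.loc e = s ∧ M.msg f e) ∧ (ξ f).1.1 ≠ none := fun f e => M.last_iff (by simp)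
  simp only [MSC.Transfer, hL, Machine.IsRun, Option.map_eq_some_iff, M.sender_eq_some,
    M.receiver_eq_some, Prod.mk.injEq]
  constructor
  · rintro ⟨h1, h2⟩
    refine ⟨fun e => (ξ e).1, fun e => ⟨rfl, fun k => ?_, ?_, fun h => ?_⟩, fun _ _ => trivial⟩
    · rw [h1]
      constructor
      · rintro ⟨f, ⟨⟨hr, hs, hm⟩, -⟩, hk⟩
        exact ⟨_, ⟨f, hm, hr, rfl⟩, hs, hk⟩
      · rintro ⟨_, ⟨f, hm, hr, rfl⟩, hs, hk⟩
        exact ⟨f, ⟨⟨hr, hs, hm⟩, by simp [hk]⟩, hk⟩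
    · rintro _ ⟨f, hm, hr, rfl⟩ hs
      rw [h2]
      constructor
      · rintro ⟨e', ⟨⟨-, -, hm'⟩, hn⟩, he⟩
        obtain ⟨-, rfl⟩ := M.msg_unique hm hm' (by simp)
        exact ⟨hn, he⟩
      · exact fun h => ⟨e, ⟨⟨hr, hs, hm⟩, h.1⟩, h.2⟩
    · obtain ⟨f, ⟨⟨hr, hs, hm⟩, -⟩, -⟩ := (h2 e).1 h
      exact ⟨hr, f, hm, hs⟩
  · rintro ⟨σ, hσ, -⟩
    obtain rfl : σ = fun e => (ξ e).1 := funext fun e => (hσ e).1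
    refine ⟨fun e k => ?_, fun f => ?_⟩
    · rw [(hσ e).2.1]
      constructor
      · rintro ⟨_, ⟨f, hm, hr, rfl⟩, hs, hk⟩
        exact ⟨f, ⟨⟨hr, hs, hm⟩, by simp [hk]⟩, hk⟩
      · rintro ⟨f, ⟨⟨hr, hs, hm⟩, -⟩, hk⟩
        exact ⟨_, ⟨f, hm, hr, rfl⟩, hs, hk⟩
    · constructor
      · intro h
        obtain ⟨hr, e, hm, hs⟩ := (hσ f).2.2.2 h
        have h' := ((hσ e).2.2.1 _ ⟨f, hm, hr, rfl⟩ hs).1 h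
        exact ⟨e, ⟨⟨hr, hs, hm⟩, h'.1⟩, h'.2⟩
      · rintro ⟨e, ⟨⟨hr, hs, hm⟩, hn⟩, he⟩
        exact ((hσ e).2.2.1 _ ⟨f, hm, hr, rfl⟩ hs).2 ⟨hn, he⟩

open Classical in
theorem transfer_star : Rec P A TransferLabel 3 fun M ξ =>
    M.Transfer .star (fun e => (ξ e).1.1) (fun e => (ξ e).1.2) (fun e => (ξ e).2.1)
      (fun e => (ξ e).2.2) := by
  -- The first component is the colour of the last coloured event so far. The second predicts a user
  -- marked by `H` later on the process, with no coloured event up to it. Predictions are checked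
  -- only once a colour has been seen, because the initial state must predict nothing.
  refine ⟨Option Bool × Bool, inferInstance, ⟨(none, false), fun _ s _ _ _ l s' =>
    s'.1 = l.1.1.or s.1 ∧ l.2.1 = s'.1 ∧
    (l.1.2 = true ↔ l.1.1 ≠ none ∧ (l.2.2 = true ∨ s'.2 = true)) ∧
    (s.1 ≠ none → (s.2 = true ↔ l.1.1 = none ∧ (l.2.2 = true ∨ s'.2 = true))),
    fun s => s.2 = false, rfl⟩, card_transferState, fun M ξ => ?_⟩
  simp only [MSC.Transfer, MSC.exists_last_star_iff]
  set D : M.E → Prop := fun f => (ξ f).1.1 ≠ none with hD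
  set H : M.E → Prop := fun f => (ξ f).2.2 = true with hH
  constructor
  · rintro ⟨h1, h2⟩
    have hU : ∀ e, (H e ∨ ∃ g, M.proc e g ∧ ¬ D g ∧ M.Until D H g) ↔ M.Until D H e :=
      fun e => M.until_iff.symm
    refine ⟨fun e => ((ξ e).2.1, decide (∃ g, M.proc e g ∧ ¬ D g ∧ M.Until D H g)),
      fun e => ⟨Option.ext fun k => ?_, rfl, ?_, ?_⟩, fun e he => ?_⟩
    · rw [h1]
      by_cases hDe : D e
      · simp only [M.last_star_of_mem hDe, exists_eq_left]
        obtain ⟨j, hj⟩ := Option.ne_none_iff_exists'.1 hDe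
        rw [hj]; rfl
      · simp only [M.last_star_of_notMem hDe]
        rw [not_not.1 hDe, Option.none_or]
        rcases hp : M.prev e with _ | f
        · rw [M.prev_eq_none] at hp
          simp [hp]
        · rw [M.prev_eq_some] at hp
          change _ ↔ (ξ f).2.1 = some k
          rw [h1]
          constructor
          · rintro ⟨g, ⟨f', hf', hg⟩, hk⟩
            exact ⟨g, M.proc_left_unique hp hf' ▸ hg, hk⟩
          · rintro ⟨g, hg, hk⟩
            exact ⟨g, ⟨f, hp, hg⟩, hk⟩
    · rw [h2]
      simp only [decide_eq_true_eq]
      exact and_congr Iff.rfl (hU e).symm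
    · rcases hp : M.prev e with _ | f
      · simp
      · rw [M.prev_eq_some] at hp
        simp only [Option.elim_some, decide_eq_true_eq]
        intro _
        rw [show ((ξ e).2.2 = true ∨ _) ↔ _ from hU e]
        constructor
        · rintro ⟨g, hg, h⟩
          obtain rfl := M.proc_right_unique hp hg
          exact ⟨not_not.1 h.1, h.2⟩
        · exact fun h => ⟨e, hp, not_not.2 h.1, h.2⟩
    · simpa using fun g hg => absurd hg (he g)
  · rintro ⟨σ, hσ, hacc⟩
    have hv : ∀ e k, (σ e).1 = some k ↔ ∃ f, M.Last .star D f e ∧ (ξ f).1.1 = some k := by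
      intro e
      induction e using (wellFounded_lt (α := M.E)).induction with
      | _ e ih =>
        intro k
        rw [(hσ e).1]
        by_cases hDe : D e
        · simp only [M.last_star_of_mem hDe, exists_eq_left]
          obtain ⟨j, hj⟩ := Option.ne_none_iff_exists'.1 hDe
          rw [hj]; rfl
        · simp only [M.last_star_of_notMem hDe]
          rw [not_not.1 hDe, Option.none_or]
          rcases hp : M.prev e with _ | f
          · rw [M.prev_eq_none] at hp
            simp [hp]
          · rw [M.prev_eq_some] at hp
            change (σ f).1 = some k ↔ _
            rw [ih f (M.lt_of_proc hp)]
            constructor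
            · rintro ⟨g, hg, hk⟩
              exact ⟨g, ⟨f, hp, hg⟩, hk⟩
            · rintro ⟨g, ⟨f', hf', hg⟩, hk⟩
              exact ⟨g, M.proc_left_unique hp hf' ▸ hg, hk⟩
    -- Predictions are verified backwards from the last event of the process, where acceptance
    -- forces `false`.
    have hu : ∀ e, (σ e).1 ≠ none → ((H e ∨ (σ e).2 = true) ↔ M.Until D H e) := by
      intro e
      induction e using (wellFounded_gt (α := M.E)).induction with
      | _ e ih =>
        intro he
        rw [M.until_iff]
        refine or_congr Iff.rfl ?_
        by_cases hp : ∃ g, M.proc e g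
        · obtain ⟨g, hg⟩ := hp
          have h := (hσ g).2.2.2
          rw [M.prev_eq_some.2 hg] at h
          have hge : (σ g).1 ≠ none := by
            rw [(hσ g).1, M.prev_eq_some.2 hg]
            simp only [Option.elim_some, ne_eq, Option.or_eq_none_iff]
            exact fun h => he h.2
          rw [show (σ e).2 = true ↔ _ from h he,
            show ((ξ g).2.2 = true ∨ _) ↔ _ from ih g (M.lt_of_proc hg) hge]
          constructor
          · exact fun h => ⟨g, hg, not_not.2 h.1, h.2⟩
          · rintro ⟨g', hg', h⟩
            obtain rfl := M.proc_right_unique hg hg'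
            exact ⟨not_not.1 h.1, h.2⟩
        · rw [show (σ e).2 = false from hacc e fun g hg => hp ⟨g, hg⟩]
          simpa using fun g hg => absurd ⟨g, hg⟩ hp
    refine ⟨fun e k => by rw [(hσ e).2.1, hv], fun f => ?_⟩
    rw [(hσ f).2.2.1]
    refine and_congr_right fun hf => hu f ?_
    rw [(hσ f).1]
    simp only [ne_eq, Option.or_eq_none_iff]
    exact fun h => hf h.1

theorem transfer (x : Letter P A) : Rec P A TransferLabel 3 fun M ξ =>
    M.Transfer x (fun e => (ξ e).1.1) (fun e => (ξ e).1.2) (fun e => (ξ e).2.1)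
      (fun e => (ξ e).2.2) := by
  cases x with
  | succ => exact transfer_succ
  | star => exact transfer_star
  | msg r s h => exact transfer_msg r s h
  | test a => exact transfer_test a

theorem transport (π : PathExpr P A) :
    Rec P A ((Bool × Bool) × (Option Bool × Bool)) (3 * π.length) fun M ξ =>
      M.Transport π (fun e => (ξ e).1.1) (fun e => (ξ e).1.2) (fun e => (ξ e).2.1)
        (fun e => (ξ e).2.2) := by
  induction π using List.reverseRecOn with
  | nil =>
    exact (all_events fun _ _ l => l.2.1 = some l.1.1 ∧ l.1.2 = l.2.2).congr
      fun M ξ => M.transport_nil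
  | append_singleton π x ih =>
    rw [List.length_append, List.length_singleton, mul_add]
    exact ((ih.comap fun l : ((Bool × Bool) × (Option Bool × Bool)) × (Option Bool × Bool) =>
      (l.1.1, l.2)).and ((transfer x).comap fun l => (l.2, l.1.2))).proj.congr
      fun M ξ => M.transport_concat

end Rec

/-! ### Parity certificates for the comparison of two monotone maps -/

section Certificate

variable {D L : Type} [LinearOrder D] [LinearOrder L] [Finite D]

/-- The conditions by which a set `R ⊆ H` of representatives certifies `α ≤ β` on `H`. -/
structure Certificate (H R : Set D) (α β : D → L) : Prop where
  subset : R ⊆ H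
  left : ∀ e ∈ R, Odd (β '' R ∩ Set.Iio (α e)).ncard ↔ Odd (R ∩ Set.Iio e).ncard
  right : ∀ e ∈ R, Odd (β '' R ∩ Set.Iio (β e)).ncard ↔ Odd (R ∩ Set.Iio e).ncard
  other : ∀ e ∈ H, e ∉ R → (Odd (β '' R ∩ Set.Iio (α e)).ncard ↔ ¬ Odd (R ∩ Set.Iio e).ncard)
  between : ∀ s ∈ β '' R, ∃ t ∈ α '' R, t ≤ s ∧ ∀ s' ∈ β '' R, t ≤ s' → ¬ s' < s

theorem exists_last_below {R : Set D} {e : D} (h : ∃ r ∈ R, r < e) :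
    ∃ r ∈ R, r < e ∧ (∀ r' ∈ R, r' < e → r' ≤ r) ∧
      (R ∩ Set.Iio e).ncard = (R ∩ Set.Iio r).ncard + 1 := by
  obtain ⟨r, hr, hm⟩ := (Set.toFinite (R ∩ Set.Iio e)).exists_maximal h
  have hm' : ∀ r' ∈ R, r' < e → r' ≤ r := fun r' h1 h2 =>
    (le_total r' r).elim id fun h3 => hm ⟨h1, h2⟩ h3
  refine ⟨r, hr.1, hr.2, hm', ?_⟩
  rw [← Set.ncard_insert_of_notMem (a := r) (by simp)]
  congr 1
  ext x
  simp only [Set.mem_inter_iff, Set.mem_Iio, Set.mem_insert_iff]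
  constructor
  · rintro ⟨h1, h2⟩
    exact (hm' x h1 h2).eq_or_lt.imp id fun h3 => ⟨h1, h3⟩
  · rintro (rfl | ⟨h1, h2⟩)
    · exact hr
    · exact ⟨h1, h2.trans hr.2⟩

/-- Induction along `R`, with `d` the representative just before `e`. If `β d = β e` or `α e ≤ β d`,
then `d` and `e` would see the same points of `β '' R`, below their `β`-values or their `α`-values
respectively, although consecutive representatives require opposite parities. Hence `β d < α e`. The
`α e'` that `between` provides for `β e` cannot have `e' < e`, as `β d` would lie in between; so `α
e ≤ α e' ≤ β e`. -/
theorem Certificate.sound_on {H R : Set D} {α β : D → L} (h : Certificate H R α β)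
    (hα : MonotoneOn α H) (hβ : MonotoneOn β H) {e : D} (he : e ∈ R) :
    α e ≤ β e ∧ ∀ r ∈ R, β r < β e → β r < α e := by
  induction e using (wellFounded_lt (α := D)).induction with
  | _ e ih =>
    obtain ⟨_, ⟨e', he', rfl⟩, hle, hbet⟩ := h.between _ ⟨e, he, rfl⟩
    by_cases hex : ∃ r ∈ R, r < e
    · obtain ⟨d, hd, hde, hmax, hcard⟩ := exists_last_below hex
      obtain ⟨ih1, ih2⟩ := ih d hde hd
      have hβde : β d < β e := by
        refine lt_of_le_of_ne (hβ (h.subset hd) (h.subset he) hde.le) fun heq => ?_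
        have h1 := h.right d hd
        rw [heq, h.right e he, hcard, Nat.odd_add_one] at h1
        tauto
      have hdα : β d < α e := by
        by_contra hcon
        have heq : β '' R ∩ Set.Iio (α e) = β '' R ∩ Set.Iio (α d) := by
          ext s
          simp only [Set.mem_inter_iff, Set.mem_Iio]
          refine and_congr_right ?_
          rintro ⟨r, hr, rfl⟩
          exact ⟨fun hs => ih2 r hr (lt_of_lt_of_le hs (not_lt.1 hcon)),
            fun hs => lt_of_lt_of_le hs (hα (h.subset hd) (h.subset he) hde.le)⟩
        have h1 := h.left e he
        rw [heq, h.left d hd, hcard, Nat.odd_add_one] at h1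
        tauto
      refine ⟨?_, fun r hr hlt => ?_⟩
      · rcases lt_or_ge e' e with hlt | hge
        · exact absurd hβde (hbet _ ⟨d, hd, rfl⟩
            ((hα (h.subset he') (h.subset hd) (hmax e' he' hlt)).trans ih1))
        · exact (hα (h.subset he) (h.subset he') hge).trans hle
      · have hre : r < e := lt_of_not_ge fun hge =>
          hlt.not_ge (hβ (h.subset he) (h.subset hr) hge)
        exact lt_of_le_of_lt (hβ (h.subset hr) (h.subset hd) (hmax r hr hre)) hdα
    · push Not at hex
      exact ⟨(hα (h.subset he) (h.subset he') (hex e' he')).trans hle, fun r hr hlt =>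
        absurd hlt (not_lt.2 (hβ (h.subset he) (h.subset hr) (hex r hr)))⟩

/-- For `e ∉ R` let `d` be the last representative before `e`. If `β e < α e`, the points of `β ''
R` below `α e` are those below `α d` and `β d` itself, so the parity at `α e` is that of the
representatives before `e`, contrary to `other`. Without such `d`, `other` asks for a point of `β ''
R` below `α e`, but all of them are at least `α e`. -/
theorem Certificate.sound {H R : Set D} {α β : D → L} (h : Certificate H R α β)
    (hα : MonotoneOn α H) (hβ : MonotoneOn β H) {e : D} (he : e ∈ H) : α e ≤ β e := by
  by_cases heR : e ∈ R
  · exact (h.sound_on hα hβ heR).1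
  have habove : ∀ r ∈ R, e ≤ r → α e ≤ β r := fun r hr hle =>
    (hα he (h.subset hr) hle).trans (h.sound_on hα hβ hr).1
  have ho := h.other e he heR
  by_cases hex : ∃ r ∈ R, r < e
  · obtain ⟨d, hd, hde, hmax, hcard⟩ := exists_last_below hex
    obtain ⟨h1, h2⟩ := h.sound_on hα hβ hd
    by_contra hcon
    have hlt : β d < α e := lt_of_le_of_lt (hβ (h.subset hd) he hde.le) (not_le.1 hcon)
    have hins : β '' R ∩ Set.Iio (α e) = insert (β d) (β '' R ∩ Set.Iio (α d)) := by
      ext s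
      simp only [Set.mem_inter_iff, Set.mem_Iio, Set.mem_insert_iff]
      constructor
      · rintro ⟨⟨r, hr, rfl⟩, hs⟩
        have hre : r < e := lt_of_not_ge fun hge => (habove r hr hge).not_gt hs
        exact (hβ (h.subset hr) (h.subset hd) (hmax r hr hre)).eq_or_lt.imp id
          fun hlt => ⟨⟨r, hr, rfl⟩, h2 r hr hlt⟩
      · rintro (rfl | ⟨hs, hlt'⟩)
        · exact ⟨⟨d, hd, rfl⟩, hlt⟩
        · exact ⟨hs, lt_of_lt_of_le hlt' (hα (h.subset hd) he hde.le)⟩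
    rw [hins, Set.ncard_insert_of_notMem (by simp [h1])
      ((Set.toFinite R).image β |>.inter_of_left _), hcard, Nat.odd_add_one, Nat.odd_add_one,
      h.left d hd] at ho
    tauto
  · push Not at hex
    have h0 : R ∩ Set.Iio e = ∅ := by
      ext r
      simpa using hex r
    rw [h0] at ho
    have hne : (β '' R ∩ Set.Iio (α e)).Nonempty := by
      rw [Set.nonempty_iff_ne_empty]
      intro h1
      simp [h1] at ho
    obtain ⟨_, ⟨r, hr, rfl⟩, hs⟩ := hne
    exact absurd hs (not_lt.2 (habove r hr (hex r hr)))

theorem exists_certificate {H : Set D} {α β : D → L} (hα : MonotoneOn α H)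
    (hβ : MonotoneOn β H) (hle : ∀ e ∈ H, α e ≤ β e) : ∃ R, Certificate H R α β := by
  -- The greedy choice of representatives, by well-founded recursion.
  obtain ⟨R, hR⟩ : ∃ R : Set D, ∀ e, e ∈ R ↔ e ∈ H ∧ ∀ r ∈ R, r < e → β r < α e := by
    let F : ∀ e : D, (∀ r, r < e → Prop) → Prop :=
      fun e ih => e ∈ H ∧ ∀ r (h : r < e), ih r h → β r < α e
    refine ⟨{e | (wellFounded_lt (α := D)).fix F e}, fun e => ?_⟩
    change (wellFounded_lt (α := D)).fix F e ↔ _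
    rw [WellFounded.fix_eq]
    exact and_congr Iff.rfl (forall_congr' fun r => forall_comm)
  have hRH : R ⊆ H := fun e he => ((hR e).1 he).1
  have hgap : ∀ r ∈ R, ∀ e ∈ R, r < e → β r < α e := fun r hr e he => ((hR e).1 he).2 r hr
  have hinj : Set.InjOn β R := by
    intro r hr e he heq
    by_contra hne
    rcases lt_or_gt_of_ne hne with hlt | hlt
    · exact ((hgap r hr e he hlt).trans_le (hle e (hRH he))).ne heq
    · exact ((hgap e he r hr hlt).trans_le (hle r (hRH hr))).ne heq.symm
  -- Every `x` in the gap between the earlier `β`-values and `β e` sees exactly the images of the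
  -- earlier representatives; `β` is injective on `R`.
  have hcard : ∀ e ∈ R, ∀ x, (∀ r ∈ R, r < e → β r < x) → x ≤ β e →
      (β '' R ∩ Set.Iio x).ncard = (R ∩ Set.Iio e).ncard := by
    intro e he x h1 h2
    rw [← (hinj.mono Set.inter_subset_left).ncard_image]
    congr 1
    ext s
    constructor
    · rintro ⟨⟨r, hr, rfl⟩, hs⟩
      exact ⟨r, ⟨hr, lt_of_not_ge fun hge =>
        (h2.trans (hβ (hRH he) (hRH hr) hge)).not_gt hs⟩, rfl⟩
    · rintro ⟨r, ⟨hr, hre⟩, rfl⟩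
      exact ⟨⟨r, hr, rfl⟩, h1 r hr hre⟩
  refine ⟨R, hRH, fun e he => ?_, fun e he => ?_, fun e he heR => ?_, ?_⟩
  · rw [hcard e he _ (fun r hr => hgap r hr e he) (hle e (hRH he))]
  · rw [hcard e he _ (fun r hr h => (hgap r hr e he h).trans_le (hle e (hRH he))) le_rfl]
  · have h1 : ∃ r ∈ R, r < e ∧ α e ≤ β r := by
      by_contra hcon
      push Not at hcon
      exact heR ((hR e).2 ⟨he, hcon⟩)
    obtain ⟨r, hr, hre, hβr⟩ := h1
    obtain ⟨d, hd, hde, hmax, hc⟩ := exists_last_below ⟨r, hr, hre⟩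
    rw [hcard d hd (α e) (fun r hr h => (hgap r hr d hd h).trans_le (hα (hRH hd) he hde.le))
      (hβr.trans (hβ (hRH hr) (hRH hd) (hmax r hr hre))), hc, Nat.odd_add_one, not_not]
  · rintro _ ⟨e, he, rfl⟩
    refine ⟨_, ⟨e, he, rfl⟩, hle e (hRH he), ?_⟩
    rintro _ ⟨r, hr, rfl⟩ h1 h2
    rcases lt_or_ge r e with hlt | hge
    · exact (hgap r hr e he hlt).not_ge h1
    · exact h2.not_ge (hβ (hRH he) (hRH hr) hge)

end Certificate

/-! ### Parity counts and the betweenness condition on an MSC -/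

namespace MSC

variable {P A : Type}

/-- The number of events marked by `S` strictly before `e` on its process. -/
noncomputable def countBefore (M : MSC P A) (S : M.E → Bool) (e : M.E) : ℕ :=
  {f | M.loc f = M.loc e ∧ f < e ∧ S f = true}.ncard

theorem countBefore_first (M : MSC P A) {S : M.E → Bool} {e : M.E} (h : ∀ f, ¬ M.proc f e) :
    M.countBefore S e = 0 := by
  rw [countBefore, Set.ncard_eq_zero, Set.eq_empty_iff_forall_notMem]
  rintro f ⟨h1, h2, -⟩
  obtain ⟨g, hg⟩ := M.exists_proc_left h1 h2
  exact h g hg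

theorem odd_countBefore_of_proc (M : MSC P A) {S : M.E → Bool} {e f : M.E} (h : M.proc f e) :
    Odd (M.countBefore S e) ↔ ¬ (Odd (M.countBefore S f) ↔ S f = true) := by
  have hl := M.proc_loc h
  by_cases hS : S f = true
  · have : M.countBefore S e = M.countBefore S f + 1 := by
      rw [countBefore, countBefore, ← Set.ncard_insert_of_notMem (a := f) (by simp)]
      congr 1
      ext g
      simp only [Set.mem_ofPred_eq, Set.mem_insert_iff]
      constructor
      · rintro ⟨h1, h2, h3⟩
        exact (M.le_of_lt_of_proc h h1 h2).eq_or_lt.imp id fun h4 => ⟨h1.trans hl.symm, h4, h3⟩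
      · rintro (rfl | ⟨h1, h2, h3⟩)
        · exact ⟨hl, M.lt_of_proc h, hS⟩
        · exact ⟨h1.trans hl, h2.trans (M.lt_of_proc h), h3⟩
    rw [this, Nat.odd_add_one]
    simp [hS]
  · have : M.countBefore S e = M.countBefore S f := by
      rw [countBefore, countBefore]
      congr 1
      ext g
      simp only [Set.mem_ofPred_eq]
      constructor
      · rintro ⟨h1, h2, h3⟩
        refine ⟨h1.trans hl.symm, lt_of_le_of_ne (M.le_of_lt_of_proc h h1 h2) ?_, h3⟩
        rintro rfl
        exact hS h3
      · rintro ⟨h1, h2, h3⟩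
        exact ⟨h1.trans hl, h2.trans (M.lt_of_proc h), h3⟩
    rw [this]
    simp [hS]

/-- Some event marked by `T` precedes `e` on its process, and no event marked by `S` is in
between. -/
def Since (M : MSC P A) (S T : M.E → Bool) (e : M.E) : Prop :=
  ∃ t, M.loc t = M.loc e ∧ t ≤ e ∧ T t = true ∧
    ∀ s, M.loc s = M.loc e → t ≤ s → s < e → ¬ S s = true

theorem since_iff (M : MSC P A) {S T : M.E → Bool} {e : M.E} :
    M.Since S T e ↔ T e = true ∨ ∃ f, M.proc f e ∧ ¬ S f = true ∧ M.Since S T f := by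
  constructor
  · rintro ⟨t, hl, hle, ht, h⟩
    rcases hle.eq_or_lt with rfl | hlt
    · exact Or.inl ht
    · obtain ⟨f, hf⟩ := M.exists_proc_left hl hlt
      have hfl := M.proc_loc hf
      have htf := M.le_of_lt_of_proc hf hl hlt
      exact Or.inr ⟨f, hf, h f hfl htf (M.lt_of_proc hf), t, hl.trans hfl.symm, htf, ht,
        fun s h1 h2 h3 => h s (h1.trans hfl) h2 (h3.trans (M.lt_of_proc hf))⟩
  · rintro (he | ⟨f, hf, hS, t, hl, hle, ht, h⟩)
    · exact ⟨e, rfl, le_rfl, he, fun s _ h1 h2 => absurd (lt_of_le_of_lt h1 h2) (lt_irrefl _)⟩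
    · have hfl := M.proc_loc hf
      refine ⟨t, hl.trans hfl, hle.trans (M.lt_of_proc hf).le, ht, fun s h1 h2 h3 => ?_⟩
      rcases (M.le_of_lt_of_proc hf h1 h3).eq_or_lt with rfl | h4
      · exact hS
      · exact h s (h1.trans hfl.symm) h2 h4

end MSC

namespace Rec

variable {P A : Type}

theorem parity : Rec P A (Bool × Bool) 1 fun M ξ =>
    ∀ e, (ξ e).2 = true ↔ Odd (M.countBefore (fun e => (ξ e).1) e) := by
  -- The state counts the current event, whereas the label counts only strictly earlier ones.
  refine ⟨Bool, inferInstance, ⟨false, fun _ s _ _ _ l s' =>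
    l.2 = s ∧ s' = (s ^^ l.1), fun _ => True, trivial⟩, by simp, fun M ξ => ?_⟩
  constructor
  · intro h
    refine ⟨fun e => ((ξ e).2 ^^ (ξ e).1), fun e => ?_, fun _ _ => trivial⟩
    have h1 : (ξ e).2 = (M.prev e).elim false fun e => ((ξ e).2 ^^ (ξ e).1) := by
      rcases hp : M.prev e with _ | f
      · rw [M.prev_eq_none] at hp
        rw [Option.elim_none, ← Bool.not_eq_true, h, M.countBefore_first hp]
        simp
      · rw [M.prev_eq_some] at hp
        rw [Option.elim_some, Bool.eq_iff_iff, h, M.odd_countBefore_of_proc hp, ← h]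
        cases (ξ f).2 <;> cases (ξ f).1 <;> simp
    exact ⟨h1, by rw [← h1]⟩
  · rintro ⟨σ, hσ, -⟩ e
    have hs : ∀ e, σ e = ((ξ e).2 ^^ (ξ e).1) := fun e => by rw [(hσ e).2, (hσ e).1]
    induction e using (wellFounded_lt (α := M.E)).induction with
    | _ e ih =>
      rw [(hσ e).1]
      rcases hp : M.prev e with _ | f
      · rw [M.prev_eq_none] at hp
        rw [M.countBefore_first hp]
        simp
      · rw [M.prev_eq_some] at hp
        have h2 : (ξ f).2 = true ↔ _ := ih f (M.lt_of_proc hp)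
        rw [Option.elim_some, M.odd_countBefore_of_proc hp, ← h2, hs]
        cases (ξ f).2 <;> cases (ξ f).1 <;> simp

open Classical in
theorem since : Rec P A (Bool × Bool) 1 fun M ξ =>
    ∀ e, (ξ e).1 = true → M.Since (fun e => (ξ e).1) (fun e => (ξ e).2) e := by
  -- The bit may be true only if some `T`-event occurred with no `S`-event since. Only this
  -- direction is enforced, as the bit is needed only as evidence at `S`-events.
  refine ⟨Bool, inferInstance, ⟨false, fun _ s _ _ _ l s' =>
    (l.1 = true → l.2 = true ∨ s = true) ∧ (s' = true → (l.2 = true ∨ s = true) ∧ ¬ l.1 = true),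
    fun _ => True, trivial⟩, by simp, fun M ξ => ?_⟩
  constructor
  · intro h
    set Q := M.Since (fun e => (ξ e).1) (fun e => (ξ e).2) with hQ
    refine ⟨fun e => decide (Q e ∧ ¬ (ξ e).1 = true), fun e => ?_, fun _ _ => trivial⟩
    have h1 : Q e → (ξ e).2 = true ∨
        (M.prev e).elim false (fun e => decide (Q e ∧ ¬ (ξ e).1 = true)) = true := by
      rw [hQ, M.since_iff]
      refine Or.imp id ?_
      rintro ⟨f, hf, hS, h⟩
      rw [M.prev_eq_some.2 hf]
      exact decide_eq_true ⟨h, hS⟩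
    exact ⟨fun hS => h1 (h e hS), fun hs => ⟨h1 (of_decide_eq_true hs).1,
      (of_decide_eq_true hs).2⟩⟩
  · rintro ⟨σ, hσ, -⟩
    have h1 : ∀ e, ((ξ e).2 = true ∨ (M.prev e).elim false σ = true) →
        M.Since (fun e => (ξ e).1) (fun e => (ξ e).2) e := by
      intro e
      induction e using (wellFounded_lt (α := M.E)).induction with
      | _ e ih =>
        rw [M.since_iff]
        refine Or.imp id fun hs => ?_
        rcases hp : M.prev e with _ | f
        · simp [hp] at hs
        · rw [hp] at hs
          rw [M.prev_eq_some] at hp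
          have h2 := (hσ f).2 hs
          exact ⟨f, hp, h2.2, ih f (M.lt_of_proc hp) h2.1⟩
    exact fun e he => h1 e ((hσ e).1 he)

end Rec

/-! ### Certificates for comparing predecessors in an MSC -/

namespace MSC

variable {P A : Type}

/-- Certificates need linear orders, while the order of an MSC is partial. A linear extension
suffices because all relevant comparisons take place within one process. -/
theorem exists_linearOrder (M : MSC P A) :
    ∃ lo : LinearOrder M.E, ∀ x y, M.loc x = M.loc y → (lo.le x y ↔ x ≤ y) := by
  refine ⟨(inferInstance : LinearOrder (LinearExtension M.E)), fun x y hxy => ⟨fun h => ?_,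
    fun h => (toLinearExtension (α := M.E)).monotone h⟩⟩
  refine (M.le_or_le hxy).elim id fun h' => ?_
  have hxy : x = y := le_antisymm (α := LinearExtension M.E) h
    ((toLinearExtension (α := M.E)).monotone h')
  exact hxy.le

/-- The marked events are located on process `q`, and for each of them there is a
`π`-predecessor, the last one being below the last `π'`-predecessor. -/
def CertLE (M : MSC P A) (q : P) (π π' : PathExpr P A) (H : M.E → Bool) : Prop :=
  ∀ e, H e = true → M.loc e = q ∧ M.pred π e ≠ ⊥ ∧ M.pred π e ≤ M.pred π' e

/-- `R` lies on process `q` and its images on `p`, so counting in the linear extension is counting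
along a process, which a machine can do. -/
theorem certificate_iff (M : MSC P A) (lo : LinearOrder M.E)
    (hlo : ∀ x y, M.loc x = M.loc y → (lo.le x y ↔ x ≤ y)) {p q : P} {H R T S : M.E → Bool}
    {α β : M.E → M.E} (hq : ∀ e, H e = true → M.loc e = q)
    (hα : ∀ e, H e = true → M.loc (α e) = p) (hβ : ∀ e, H e = true → M.loc (β e) = p)
    (hRH : ∀ e, R e = true → H e = true) (hT : ∀ g, T g = true ↔ ∃ e, R e = true ∧ α e = g)
    (hS : ∀ g, S g = true ↔ ∃ e, R e = true ∧ β e = g) :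
    @Certificate M.E M.E lo lo {e | H e = true} {e | R e = true} α β ↔
      (∀ e, R e = true → (Odd (M.countBefore S (α e)) ↔ Odd (M.countBefore R e)) ∧
        (Odd (M.countBefore S (β e)) ↔ Odd (M.countBefore R e))) ∧
      (∀ e, H e = true → ¬ R e = true →
        (Odd (M.countBefore S (α e)) ↔ ¬ Odd (M.countBefore R e))) ∧
      ∀ s, S s = true → M.Since S T s := by
  have hlt : ∀ x y, M.loc x = M.loc y → (lo.lt x y ↔ x < y) := fun x y h => by
    rw [lo.lt_iff_le_not_ge, hlo x y h, hlo y x h.symm, lt_iff_le_not_ge]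
  have hSimg : β '' {e | R e = true} = {s | S s = true} := Set.ext fun g => (hS g).symm
  have hSp : ∀ s, S s = true → M.loc s = p := fun s hs => by
    obtain ⟨e, he, rfl⟩ := (hS s).1 hs
    exact hβ e (hRH e he)
  have hTp : ∀ s, T s = true → M.loc s = p := fun s hs => by
    obtain ⟨e, he, rfl⟩ := (hT s).1 hs
    exact hα e (hRH e he)
  have hcount : ∀ (G : M.E → Bool) r, (∀ s, G s = true → M.loc s = r) → ∀ x, M.loc x = r →
      ({s | G s = true} ∩ @Set.Iio M.E lo.toPreorder x).ncard = M.countBefore G x := by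
    intro G r hG x hx
    unfold countBefore
    congr 1
    ext s
    constructor
    · rintro ⟨h1, h2⟩
      have hl := (hG s h1).trans hx.symm
      exact ⟨hl, (hlt s x hl).1 h2, h1⟩
    · rintro ⟨hl, h2, h1⟩
      exact ⟨h1, (hlt s x hl).2 h2⟩
  have hcS := hcount S p hSp
  have hcR := hcount R q fun e he => hq e (hRH e he)
  constructor
  · rintro ⟨-, h1, h2, h3, h4⟩
    rw [hSimg] at h1 h2 h3 h4
    refine ⟨fun e he => ?_, fun e he heR => ?_, fun s hs => ?_⟩
    · have he' := hRH e he
      have h1 := h1 e he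
      have h2 := h2 e he
      rw [hcS _ (hα e he'), hcR _ (hq e he')] at h1
      rw [hcS _ (hβ e he'), hcR _ (hq e he')] at h2
      exact ⟨h1, h2⟩
    · have h3 := h3 e he heR
      rwa [hcS _ (hα e he), hcR _ (hq e he)] at h3
    · obtain ⟨_, ⟨e, he, rfl⟩, hle, h⟩ := h4 s hs
      have hl : M.loc (α e) = M.loc s := (hα e (hRH e he)).trans (hSp s hs).symm
      exact ⟨α e, hl, (hlo _ _ hl).1 hle, (hT _).2 ⟨e, he, rfl⟩, fun s' hs' h5 h6 h7 =>
        h s' h7 ((hlo _ _ (hl.trans hs'.symm)).2 h5) ((hlt _ _ hs').2 h6)⟩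
  · rintro ⟨h1, h2, h3⟩
    refine @Certificate.mk M.E M.E lo lo _ _ _ _ hRH ?_ ?_ ?_ ?_ <;> rw [hSimg]
    · intro e he
      rw [hcS _ (hα e (hRH e he)), hcR _ (hq e (hRH e he))]
      exact (h1 e he).1
    · intro e he
      rw [hcS _ (hβ e (hRH e he)), hcR _ (hq e (hRH e he))]
      exact (h1 e he).2
    · intro e he heR
      rw [hcS _ (hα e he), hcR _ (hq e he)]
      exact h2 e he heR
    · intro s hs
      obtain ⟨t, hl, hle, ht, h⟩ := h3 s hs
      refine ⟨t, (hT t).1 ht, (hlo _ _ hl).2 hle, fun s' hs' h5 h6 => ?_⟩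
      have hl' := (hSp s' hs').trans (hSp s hs).symm
      exact h s' hl' ((hlo _ _ (hl.trans hl'.symm)).1 h5) ((hlt _ _ hl').1 h6) hs'

/-- The labels by which `CertLE` is verified. -/
structure CertLabels (M : MSC P A) (q : P) (π π' : PathExpr P A) (H κ T S R μ : M.E → Bool)
    (c c' : M.E → Option Bool) : Prop where
  left : M.Transport π κ T c R
  right : M.Transport π' κ S c' R
  color : ∀ e, κ e = true ↔ Odd (M.countBefore S e)
  count : ∀ e, μ e = true ↔ Odd (M.countBefore R e)
  since : ∀ e, S e = true → M.Since S T e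
  events : ∀ e, (H e = true → M.loc e = q) ∧
    (R e = true → H e = true ∧ c e = some (μ e) ∧ c' e = some (μ e)) ∧
    (H e = true → ¬ R e = true → c e = some (!μ e) ∧ c' e ≠ none)

open Classical in
theorem certLE_iff (M : MSC P A) {p q : P} {π π' : PathExpr P A} (hπ : PathComp π p q)
    (hπ' : PathComp π' p q) {H : M.E → Bool} :
    M.CertLE q π π' H ↔ ∃ κ T S R μ c c', M.CertLabels q π π' H κ T S R μ c c' := by
  have := M.nonempty_E
  obtain ⟨lo, hlo⟩ := M.exists_linearOrder
  have hloc : ∀ {π : PathExpr P A}, PathComp π p q → ∀ {e g : M.E}, M.loc e = q →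
      M.pred π e = (g : WithBot M.E) → M.loc g = p := by
    intro π hπ e g he hg
    have := M.comp_of_sem (M.pred_eq_coe.1 hg).1
    rw [he] at this
    exact this.left_unique hπ
  have hmono : ∀ {π : PathExpr P A}, PathComp π p q → ∀ {α : M.E → M.E},
      (∀ e, H e = true → M.loc e = q) → (∀ e, H e = true → M.pred π e = (α e : WithBot M.E)) →
      @MonotoneOn M.E M.E lo.toPreorder lo.toPreorder α {e | H e = true} := by
    intro π hπ α hq hα e he f hf hle
    have hl : M.loc e = M.loc f := (hq e he).trans (hq f hf).symm
    have hl' : M.loc (α e) = M.loc (α f) :=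
      (hloc hπ (hq e he) (hα e he)).trans (hloc hπ (hq f hf) (hα f hf)).symm
    exact (hlo _ _ hl').2 (M.pred_mono (hα e he) (hα f hf) hl ((hlo _ _ hl).1 hle))
  have himg : ∀ {π : PathExpr P A} {α : M.E → M.E} {R T κ : M.E → Bool} {c : M.E → Option Bool},
      (∀ e, R e = true → H e = true) → (∀ e, H e = true → M.pred π e = (α e : WithBot M.E)) →
      M.Transport π κ T c R → (∀ g, T g = true ↔ ∃ e, R e = true ∧ α e = g) ∧
      ∀ e, H e = true → ∀ k, c e = some k ↔ κ (α e) = k := by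
    intro π α R T κ c hRH hα h
    refine ⟨fun g => ?_, fun e he k => ?_⟩
    · rw [h.2]
      constructor
      · rintro ⟨e, h1, h2⟩
        exact ⟨e, h2, by rwa [hα e (hRH e h2), WithBot.coe_inj] at h1⟩
      · rintro ⟨e, h2, rfl⟩
        exact ⟨e, hα e (hRH e h2), h2⟩
    · rw [h.1, hα e he]
      simp only [WithBot.coe_inj, exists_eq_left']
  constructor
  · intro h
    have hq : ∀ e, H e = true → M.loc e = q := fun e he => (h e he).1
    have h1 : ∀ e, ∃ g : M.E, H e = true → M.pred π e = (g : WithBot M.E) := fun e => by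
      by_cases he : H e = true
      · obtain ⟨g, hg⟩ := WithBot.ne_bot_iff_exists.1 (h e he).2.1
        exact ⟨g, fun _ => hg.symm⟩
      · exact ⟨e, fun h => absurd h he⟩
    have h2 : ∀ e, ∃ g : M.E, H e = true → M.pred π' e = (g : WithBot M.E) := fun e => by
      by_cases he : H e = true
      · obtain ⟨g, hg⟩ := WithBot.ne_bot_iff_exists.1
          (ne_bot_of_le_ne_bot (h e he).2.1 (h e he).2.2)
        exact ⟨g, fun _ => hg.symm⟩
      · exact ⟨e, fun h => absurd h he⟩
    choose α hα using h1
    choose β hβ using h2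
    have hαp := fun e he => hloc hπ (hq e he) (hα e he)
    have hβp := fun e he => hloc hπ' (hq e he) (hβ e he)
    obtain ⟨Rs, hRs⟩ := @exists_certificate M.E M.E lo lo _ {e | H e = true} α β
      (hmono hπ hq hα) (hmono hπ' hq hβ) fun e he => by
        have := (h e he).2.2
        rw [hα e he, hβ e he, WithBot.coe_le_coe] at this
        exact (hlo _ _ ((hαp e he).trans (hβp e he).symm)).2 this
    obtain ⟨R, rfl⟩ : ∃ R : M.E → Bool, Rs = {e | R e = true} :=
      ⟨fun e => decide (e ∈ Rs), by simp⟩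
    have hRH : ∀ e, R e = true → H e = true := fun e he => hRs.subset he
    -- The colouring `κ` depends on `S`, but the marks `S` do not depend on the colours. They are
    -- therefore obtained from a dummy colouring, and identified below with those for `κ`.
    obtain ⟨S, _, hS⟩ := M.transport_exists π' (fun _ => false) R
    obtain ⟨κ, hκ⟩ : ∃ κ : M.E → Bool, ∀ e, κ e = true ↔ Odd (M.countBefore S e) :=
      ⟨fun e => decide (Odd (M.countBefore S e)), by simp⟩
    obtain ⟨μ, hμ⟩ : ∃ μ : M.E → Bool, ∀ e, μ e = true ↔ Odd (M.countBefore R e) :=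
      ⟨fun e => decide (Odd (M.countBefore R e)), by simp⟩
    obtain ⟨T, c, hT⟩ := M.transport_exists π κ R
    obtain ⟨S', c', hS'⟩ := M.transport_exists π' κ R
    obtain rfl : S = S' := funext fun g => Bool.eq_iff_iff.2 ((hS.2 g).trans (hS'.2 g).symm)
    obtain ⟨hT1, hT2⟩ := himg hRH hα hT
    obtain ⟨hS1, hS2⟩ := himg hRH hβ hS'
    obtain ⟨k1, k2, k3⟩ := (M.certificate_iff lo hlo hq hαp hβp hRH hT1 hS1).1 hRs
    refine ⟨κ, T, S, R, μ, c, c', hT, hS', hκ, hμ, k3, fun e => ⟨hq e, fun he => ?_,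
      fun he heR => ⟨?_, ?_⟩⟩⟩
    · refine ⟨hRH e he, (hT2 e (hRH e he) _).2 ?_, (hS2 e (hRH e he) _).2 ?_⟩
      · rw [Bool.eq_iff_iff, hκ, hμ]
        exact (k1 e he).1
      · rw [Bool.eq_iff_iff, hκ, hμ]
        exact (k1 e he).2
    · rw [hT2 e he, Bool.eq_iff_iff, hκ, Bool.not_eq_true', ← Bool.not_eq_true, hμ]
      exact k2 e he heR
    · rw [(hS2 e he _).2 rfl]
      exact Option.some_ne_none _
  · rintro ⟨κ, T, S, R, μ, c, c', hT, hS, hκ, hμ, hsince, hev⟩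
    have hq : ∀ e, H e = true → M.loc e = q := fun e => (hev e).1
    have hRH : ∀ e, R e = true → H e = true := fun e he => ((hev e).2.1 he).1
    have hc : ∀ e, H e = true → c e ≠ none ∧ c' e ≠ none := fun e he => by
      by_cases heR : R e = true
      · rw [((hev e).2.1 heR).2.1, ((hev e).2.1 heR).2.2]
        simp
      · rw [((hev e).2.2 he heR).1]
        exact ⟨Option.some_ne_none _, ((hev e).2.2 he heR).2⟩
    have h1 : ∀ e, ∃ g : M.E, H e = true → M.pred π e = (g : WithBot M.E) := fun e => by
      by_cases he : H e = true
      · obtain ⟨g, hg⟩ := WithBot.ne_bot_iff_exists.1 ((hT.ne_none_iff e).1 (hc e he).1)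
        exact ⟨g, fun _ => hg.symm⟩
      · exact ⟨e, fun h => absurd h he⟩
    have h2 : ∀ e, ∃ g : M.E, H e = true → M.pred π' e = (g : WithBot M.E) := fun e => by
      by_cases he : H e = true
      · obtain ⟨g, hg⟩ := WithBot.ne_bot_iff_exists.1 ((hS.ne_none_iff e).1 (hc e he).2)
        exact ⟨g, fun _ => hg.symm⟩
      · exact ⟨e, fun h => absurd h he⟩
    choose α hα using h1
    choose β hβ using h2
    have hαp := fun e he => hloc hπ (hq e he) (hα e he)
    have hβp := fun e he => hloc hπ' (hq e he) (hβ e he)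
    obtain ⟨hT1, hT2⟩ := himg hRH hα hT
    obtain ⟨hS1, hS2⟩ := himg hRH hβ hS
    have hcert := (M.certificate_iff lo hlo hq hαp hβp hRH hT1 hS1).2
      ⟨fun e he => ⟨?_, ?_⟩, fun e he heR => ?_, hsince⟩
    · intro e he
      refine ⟨hq e he, (hT.ne_none_iff e).1 (hc e he).1, ?_⟩
      rw [hα e he, hβ e he, WithBot.coe_le_coe]
      exact (hlo _ _ ((hαp e he).trans (hβp e he).symm)).1
        (@Certificate.sound M.E M.E lo lo _ _ _ _ _ hcert (hmono hπ hq hα) (hmono hπ' hq hβ) e he)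
    · rw [← hκ, ← hμ, ← Bool.eq_iff_iff]
      exact (hT2 e (hRH e he) _).1 ((hev e).2.1 he).2.1
    · rw [← hκ, ← hμ, ← Bool.eq_iff_iff]
      exact (hS2 e (hRH e he) _).1 ((hev e).2.1 he).2.2
    · rw [← hκ, ← hμ, (hT2 e he _).1 ((hev e).2.2 he heR).1]
      simp

open Classical in
-- A true bit is justified by `pred π e = ⊥` or a certified inequality. A false bit needs `pred π e
-- ≠ ⊥`, and either `pred π' e = ⊥` or a certified inequality against `.succ :: π`, which makes the
-- comparison strict.
theorem prefLE_iff (M : MSC P A) {p q : P} {π π' : PathExpr P A} (hπ : PathComp π p q)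
    (hπ' : PathComp π' p q) {b : M.E → Bool} :
    (∀ e, M.loc e = q → (b e = true ↔ M.PrefLE e π π')) ↔
      ∃ H H' κ G κ' G' I I' : M.E → Bool, ∃ c c' : M.E → Option Bool,
        M.CertLE q π π' H ∧ M.CertLE q π' (.succ :: π) H' ∧
        M.Transport π κ G c I ∧ M.Transport π' κ' G' c' I' ∧
        ∀ e, M.loc e = q → (b e = true → c e = none ∨ H e = true) ∧
          (¬ b e = true → c e ≠ none ∧ (c' e = none ∨ H' e = true)) := by
  unfold PrefLE
  constructor
  · intro h
    -- The colours are arbitrary: these transports serve only to detect whether the predecessor is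
    -- `⊥`.
    obtain ⟨G, c, hc⟩ := M.transport_exists π (fun _ => false) fun _ => false
    obtain ⟨G', c', hc'⟩ := M.transport_exists π' (fun _ => false) fun _ => false
    refine ⟨fun e => decide (M.loc e = q ∧ b e = true ∧ M.pred π e ≠ ⊥),
      fun e => decide (M.loc e = q ∧ ¬ b e = true ∧ M.pred π' e ≠ ⊥), _, G, _, G', _, _, c, c',
      fun e he => ?_, fun e he => ?_, hc, hc', fun e he => ⟨fun hb => ?_, fun hb => ?_⟩⟩
    · obtain ⟨h1, h2, h3⟩ := of_decide_eq_true he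
      exact ⟨h1, h3, (h e h1).1 h2⟩
    · obtain ⟨h1, h2, h3⟩ := of_decide_eq_true he
      refine ⟨h1, h3, ?_⟩
      have hle := mt (h e h1).2 h2
      obtain ⟨g', hg'⟩ := WithBot.ne_bot_iff_exists.1 h3
      have h4 : M.pred π e ≠ ⊥ := fun h4 => hle (h4 ▸ bot_le)
      obtain ⟨g, hg⟩ := WithBot.ne_bot_iff_exists.1 h4
      rw [← hg, ← hg', WithBot.coe_le_coe] at hle
      have hl : M.loc g' = M.loc g := by
        have k1 := M.comp_of_sem (M.pred_eq_coe.1 hg'.symm).1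
        have k2 := M.comp_of_sem (M.pred_eq_coe.1 hg.symm).1
        rw [h1] at k1 k2
        exact (k1.left_unique hπ').trans (k2.left_unique hπ).symm
      have hlt : g' < g :=
        lt_of_le_not_ge ((M.le_or_le hl).elim id fun h => absurd h hle) hle
      obtain ⟨f, hf⟩ := M.exists_proc_left hl hlt
      rw [← hg', M.pred_succ_cons.2 ⟨g, hf, hg.symm⟩, WithBot.coe_le_coe]
      exact M.le_of_lt_of_proc hf hl hlt
    · rw [or_iff_not_imp_left]
      exact fun hn => decide_eq_true ⟨he, hb, (hc.ne_none_iff e).1 hn⟩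
    · refine ⟨(hc.ne_none_iff e).2 fun h4 => mt (h e he).2 hb (h4 ▸ bot_le), ?_⟩
      rw [or_iff_not_imp_left]
      exact fun hn => decide_eq_true ⟨he, hb, (hc'.ne_none_iff e).1 hn⟩
  · rintro ⟨H, H', κ, G, κ', G', I, I', c, c', hH, hH', hc, hc', h⟩ e he
    constructor
    · intro hb
      rcases (h e he).1 hb with hn | hHe
      · rw [not_not.1 (mt (hc.ne_none_iff e).2 (not_not.2 hn))]
        exact bot_le
      · exact (hH e hHe).2.2
    · intro hle
      by_contra hb
      obtain ⟨hn, h'⟩ := (h e he).2 hb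
      rw [hc.ne_none_iff] at hn
      rcases h' with hn' | hHe
      · rw [not_not.1 (mt (hc'.ne_none_iff e).2 (not_not.2 hn'))] at hle
        exact hn (le_bot_iff.1 hle)
      · obtain ⟨-, h1, h2⟩ := hH' e hHe
        obtain ⟨f, hf⟩ := WithBot.ne_bot_iff_exists.1 (ne_bot_of_le_ne_bot h1 h2)
        obtain ⟨g, hg, hg'⟩ := M.pred_succ_cons.1 hf.symm
        rw [hg'] at hle
        have h3 := hle.trans h2
        rw [← hf, WithBot.coe_le_coe] at h3
        exact (lt_of_le_of_lt h3 (M.lt_of_proc hg)).false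

end MSC

/-! ### Machines for comparing predecessors -/

namespace Rec

variable {P A : Type}

theorem certLE {p q : P} {π π' : PathExpr P A} (hπ : PathComp π p q) (hπ' : PathComp π' p q) :
    Rec P A Bool (3 * π.length + 3 * π'.length + 3) fun M H => M.CertLE q π π' H := by
  have h := ((((((transport π).comap
      fun l : Bool × ((Bool × Bool × Bool × Bool × Bool) × (Option Bool × Option Bool)) =>
        ((l.2.1.1, l.2.1.2.1), (l.2.2.1, l.2.1.2.2.2.1))).and ((transport π').comap
      fun l => ((l.2.1.1, l.2.1.2.2.1), (l.2.2.2, l.2.1.2.2.2.1)))).and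
    (parity.comap fun l => (l.2.1.2.2.1, l.2.1.1))).and
    (parity.comap fun l => (l.2.1.2.2.2.1, l.2.1.2.2.2.2))).and
    (since.comap fun l => (l.2.1.2.2.1, l.2.1.2.1))).and
    (all_events fun r _ l => (l.1 = true → r = q) ∧
      (l.2.1.2.2.2.1 = true → l.1 = true ∧ l.2.2.1 = some l.2.1.2.2.2.2 ∧
        l.2.2.2 = some l.2.1.2.2.2.2) ∧
      (l.1 = true → ¬ l.2.1.2.2.2.1 = true → l.2.2.1 = some (!l.2.1.2.2.2.2) ∧
        l.2.2.2 ≠ none))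
  -- Two transports, and one bit each for the two parities and the betweenness condition.
  refine (h.proj.mono (by omega)).congr fun M H => ?_
  rw [M.certLE_iff hπ hπ']
  constructor
  · rintro ⟨κ, T, S, R, μ, c, c', h⟩
    exact ⟨fun e => ((κ e, T e, S e, R e, μ e), (c e, c' e)),
      ⟨⟨⟨⟨h.left, h.right⟩, h.color⟩, h.count⟩, h.since⟩, h.events⟩
  · rintro ⟨ζ, ⟨⟨⟨⟨h1, h2⟩, h3⟩, h4⟩, h5⟩, h6⟩
    exact ⟨_, _, _, _, _, _, _, h1, h2, h3, h4, h5, h6⟩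

theorem prefLE {p q : P} {π π' : PathExpr P A} (hπ : PathComp π p q) (hπ' : PathComp π' p q) :
    Rec P A Bool (9 * (π.length + π'.length) + 9) fun M b =>
      ∀ e, M.loc e = q → (b e = true ↔ M.PrefLE e π π') := by
  have hs : PathComp (.succ :: π) p q := ⟨p, rfl, hπ⟩
  have h := (((((certLE hπ hπ').comap
      fun l : Bool × ((Bool × Bool) × (Bool × Bool × Bool × Bool × Bool × Bool) ×
        (Option Bool × Option Bool)) => l.2.1.1).and
    ((certLE hπ' hs).comap fun l => l.2.1.2)).and
    ((transport π).comap fun l => ((l.2.2.1.1, l.2.2.1.2.1),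
      (l.2.2.2.1, l.2.2.1.2.2.2.2.1)))).and
    ((transport π').comap fun l => ((l.2.2.1.2.2.1, l.2.2.1.2.2.2.1),
      (l.2.2.2.2, l.2.2.1.2.2.2.2.2)))).and
    (all_events fun r _ l => r = q → (l.1 = true → l.2.2.2.1 = none ∨ l.2.1.1 = true) ∧
      (¬ l.1 = true → l.2.2.2.1 ≠ none ∧ (l.2.2.2.2 = none ∨ l.2.1.2 = true)))
  -- The two certificates take `6 * (|π| + |π'|) + 9` bits, including three for the additional
  -- `.succ`; the two transports take the rest.
  refine (h.proj.mono (by simp only [List.length_cons]; omega)).congr fun M b => ?_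
  rw [M.prefLE_iff hπ hπ']
  constructor
  · rintro ⟨H, H', κ, G, κ', G', I, I', c, c', h1, h2, h3, h4, h5⟩
    exact ⟨fun e => ((H e, H' e), (κ e, G e, κ' e, G' e, I e, I' e), (c e, c' e)),
      ⟨⟨⟨h1, h2⟩, h3⟩, h4⟩, h5⟩
  · rintro ⟨ζ, ⟨⟨⟨h1, h2⟩, h3⟩, h4⟩, h5⟩
    exact ⟨_, _, _, _, _, _, _, _, _, _, h1, h2, h3, h4, h5⟩

end Rec

/-! ### All pairs of expressions: state bound and conclusion -/

theorem card_le_pathSize {P A : Type} (Pi : Finset (PathExpr P A)) :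
    Pi.card ≤ pathSize Pi + 1 := by
  classical
  have h1 : (Pi.erase []).card ≤ pathSize Pi := by
    rw [Finset.card_eq_sum_ones]
    refine (Finset.sum_le_sum fun π hπ => ?_).trans
      (Finset.sum_le_sum_of_subset (Finset.erase_subset _ _))
    exact List.length_pos_iff.2 (Finset.ne_of_mem_erase hπ)
  exact Nat.sub_le_iff_le_add.1 ((Finset.pred_card_le_card_erase (a := [])).trans h1)

open Classical in
-- Two distinct expressions are not both empty, so the additive `9` is absorbed by doubling the
-- factor `9`. Summation gives at most `18 * (N * N + (N + 1) * N) ≤ 54 * N ^ 2`.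
theorem sum_pairs_le {P A : Type} (Pi : Finset (PathExpr P A)) :
    ∑ π ∈ Pi, ∑ π' ∈ Pi.erase π, (9 * (π.length + π'.length) + 9) ≤ 54 * pathSize Pi ^ 2 := by
  set N := pathSize Pi with hN
  have h1 : ∀ π ∈ Pi, ∑ π' ∈ Pi.erase π, (9 * (π.length + π'.length) + 9) ≤
      18 * (N * π.length + N) := by
    intro π hπ
    calc ∑ π' ∈ Pi.erase π, (9 * (π.length + π'.length) + 9)
        ≤ ∑ π' ∈ Pi.erase π, 18 * (π.length + π'.length) := by
          refine Finset.sum_le_sum fun π' hπ' => ?_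
          have : π.length + π'.length ≠ 0 := fun h0 => by
            have h2 : π = [] := List.length_eq_zero_iff.1 (by omega)
            have h3 : π' = [] := List.length_eq_zero_iff.1 (by omega)
            exact Finset.ne_of_mem_erase hπ' (h3.trans h2.symm)
          omega
      _ = 18 * ((Pi.erase π).card * π.length + ∑ π' ∈ Pi.erase π, π'.length) := by
          rw [← Finset.mul_sum, Finset.sum_add_distrib, Finset.sum_const, smul_eq_mul]
      _ ≤ 18 * (N * π.length + N) := by
          have h2 : (Pi.erase π).card ≤ N := by
            have := card_le_pathSize Pi
            rw [Finset.card_erase_of_mem hπ]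
            omega
          have h3 : ∑ π' ∈ Pi.erase π, π'.length ≤ N :=
            Finset.sum_le_sum_of_subset (Finset.erase_subset _ _)
          gcongr
  refine (Finset.sum_le_sum h1).trans ?_
  rw [← Finset.mul_sum, Finset.sum_add_distrib, ← Finset.mul_sum, Finset.sum_const, smul_eq_mul,
    show ∑ π ∈ Pi, π.length = N from rfl]
  have h2 := Nat.mul_le_mul_right N (card_le_pathSize Pi)
  have h3 : N ≤ N * N := Nat.le_mul_self N
  rw [← hN] at h2
  nlinarith

open Classical in
-- Only distinct pairs are checked: reflexivity settles the diagonal. This matters for `Π = {[]}`,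
-- where the bound allows a single state.
theorem Rec.prefOrd {P A : Type} {p q : P} (Pi : Finset (PathExpr P A))
    (hPi : ∀ π ∈ Pi, π ∈ Paths A p q) :
    Rec P A (PreOrd {π : PathExpr P A // π ∈ Pi}) (54 * pathSize Pi ^ 2) fun M γ =>
      ∀ e, M.loc e = q → γ e = M.prefOrd Pi e := by
  have h := Rec.finset_all (B := PreOrd {π : PathExpr P A // π ∈ Pi}) Pi _
    (fun π M γ => ∀ π' ∈ Pi.erase π, ∀ (h : π ∈ Pi) (h' : π' ∈ Pi), ∀ e, M.loc e = q →
      (decide ((γ e).1 ⟨π, h⟩ ⟨π', h'⟩) = true ↔ M.PrefLE e π π')) fun π hπ =>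
    Rec.finset_all (Pi.erase π) _ _ fun π' hπ' =>
      ((Rec.prefLE (hPi π hπ) (hPi π' (Finset.mem_of_mem_erase hπ'))).comap
        fun γ : PreOrd {π : PathExpr P A // π ∈ Pi} =>
          decide (γ.1 ⟨π, hπ⟩ ⟨π', Finset.mem_of_mem_erase hπ'⟩)).congr fun M γ => by
        simp only [hπ, Finset.mem_of_mem_erase hπ', forall_true_left]
  refine (h.mono (sum_pairs_le Pi)).congr fun M γ => ?_
  constructor
  · intro h π _ π' _ hπ hπ' e he
    rw [h e he, decide_eq_true_eq]
    rfl
  · intro h e he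
    refine Subtype.ext (funext fun π => funext fun π' => propext ?_)
    by_cases heq : π = π'
    · subst heq
      exact ⟨fun _ => (M.prefOrd Pi e).2.1 π, fun _ => (γ e).2.1 π⟩
    · have h1 := h π.1 π.2 π'.1 (Finset.mem_erase.2 ⟨fun h => heq (Subtype.ext h.symm), π'.2⟩)
        π.2 π'.2 e he
      rw [decide_eq_true_eq] at h1
      exact h1

end Gossip

theorem mainTheorem2 :
    ∃ c : ℕ, ∀ (P A : Type) [Finite P] [Finite A] (p q : P)
      (Pi : Finset (Gossip.PathExpr P A)), (∀ π ∈ Pi, π ∈ Gossip.Paths A p q) →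
      ∃ C : Gossip.CFM P (A × Gossip.PreOrd {π : Gossip.PathExpr P A // π ∈ Pi}),
        (∀ r : P, Nat.card (C.S r) ≤ 2 ^ (c * Gossip.pathSize Pi ^ 2)) ∧
        C.language = {N | ∀ e : N.base.E, N.base.loc e = q →
          N.ext e = N.base.prefOrd Pi e} :=
  ⟨54, fun _ _ _ _ _ _ Pi hPi => (Gossip.Rec.prefOrd Pi hPi).exists_cfm⟩
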